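/- All graphs are finite and simple. A graph is \emph{1-planar} if it can be drawn in the plane with at most one crossing per edge, and a graph with $n\ge 3$ vertices is \emph{optimal 1-planar} if it is 1-planar and has exactly $4n-8$ edges. For $k\ge 3$ the \emph{extended wheel graph} $XW_{2k}$ consists of a cycle $(v_1,\dots,v_{2k})$, all edges between vertices at distance two on this cycle, and two non-adjacent vertices (poles), each adjacent to every $v_i$. Let $x$ be a vertex of degree six of a graph $G$ whose neighbours can be labelled $x_1,\dots,x_6$ so that $G$ contains the edges of the hexagon $(x_1,x_2,x_3,x_4,x_5,x_6)$ and of the triangle $(x_1,x_3,x_5)$, and does not contain the edges $\{x_2,x_4\}$, $\{x_6,x_4\}$, $\{x_1,x_4\}$. Then the (feasible) \emph{$SR$-reduction} $SR(x\mapsto x_4)$ transforms $G$ into the graph $G'$ obtained from $G$ by deleting the vertex $x$ and the edge $\{x_3,x_5\}$ and adding the edges $\{x_4,x_1\}$, $\{x_4,x_2\}$, $\{x_4,x_6\}$. A \emph{separating 4-cycle} of $G$ is a cycle of length four in $G$ such that removing its four vertices leaves a disconnected graph. Then: (1) The 5-connected optimal 1-planar graphs are not closed under $SR$-reductions: there are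 a 5-connected optimal 1-planar graph $G$ and an $SR$-reduction of $G$ to an optimal 1-planar graph $G'$ that is not 5-connected. (2) If $G$ is an optimal 1-planar graph with a separating 4-cycle and $H$ is obtained from $G$ by a finite (possibly empty) sequence of $SR$-reductions, then $H$ is not (isomorphic to) an extended wheel graph. -/

import Mathlib

universe u v

namespace OptimalOnePlanar

section Planarity

variable {V : Type u}

/-- Reversal of darts (half-edges), as a permutation. -/
def reversePerm (G : SimpleGraph V) : Equiv.Perm G.Dart :=
  Function.Involutive.toPerm (SimpleGraph.Dart.symm (G := G))
    SimpleGraph.Dart.symm_involutive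

/-- A rotation system: a permutation of the darts whose cycles are exactly the sets of darts
leaving a common vertex, i.e. a cyclic order of the edges around each vertex. -/
def IsRotationSystem (G : SimpleGraph V) (σ : Equiv.Perm G.Dart) : Prop :=
  ∀ d e : G.Dart, σ.SameCycle d e ↔ d.fst = e.fst

/-- The number of facial walks of a rotation system, i.e. the number of cycles of the permutation
that sends a dart to the rotation successor of its reversal. -/
noncomputable def faceCount (G : SimpleGraph V) (σ : Equiv.Perm G.Dart) : ℕ :=
  Nat.card (Quotient (Equiv.Perm.SameCycle.setoid (σ * reversePerm G)))

/-- The rotation system `σ` of the finite graph `G` describes a planar embedding: every connected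
component satisfies Euler's formula `|V| - |E| + |F| = 2`. As `|V| - |E| + |F| ≤ 2` holds for
every component, it suffices to sum over the components. An isolated vertex has one
face, but no dart, hence these faces are counted separately. -/
def IsPlanarRotation (G : SimpleGraph V) (σ : Equiv.Perm G.Dart) : Prop :=
  IsRotationSystem G σ ∧
    Nat.card V + (faceCount G σ + {v : V | ∀ w, ¬ G.Adj v w}.ncard) =
      G.edgeSet.ncard + 2 * Nat.card G.ConnectedComponent

/-- The combinatorial part of a 1-planar drawing of `G`: the set of unordered pairs of crossing
edges. Each edge is crossed at most once. As usual, edges with a common endpoint do not cross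
(such a crossing can always be removed by exchanging the two initial segments). -/
structure CrossingPattern (G : SimpleGraph V) where
  /-- The unordered pairs of crossing edges. -/
  pairs : Set (Sym2 (Sym2 V))
  isEdge : ∀ p ∈ pairs, ∀ e ∈ p, e ∈ G.edgeSet
  disjoint : ∀ e f : Sym2 V, s(e, f) ∈ pairs → ∀ w, w ∈ e → w ∉ f
  crossedOnce : ∀ p ∈ pairs, ∀ q ∈ pairs, ∀ e, e ∈ p → e ∈ q → p = q

/-- The planarization: uncrossed edges are kept, and every crossing is a virtual vertex adjacent
to the four endpoints of the two crossing edges. -/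
def CrossingPattern.planarization {G : SimpleGraph V} (C : CrossingPattern G) :
    SimpleGraph (V ⊕ C.pairs) where
  Adj a b := match a, b with
    | Sum.inl a, Sum.inl b => G.Adj a b ∧ ∀ p ∈ C.pairs, s(a, b) ∉ p
    | Sum.inl a, Sum.inr p => ∃ e ∈ p.1, a ∈ e
    | Sum.inr p, Sum.inl a => ∃ e ∈ p.1, a ∈ e
    | Sum.inr _, Sum.inr _ => False
  symm := ⟨by
    rintro (a | p) (b | q) h
    · exact ⟨h.1.symm, fun p hp => by rw [Sym2.eq_swap]; exact h.2 p hp⟩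
    · exact h
    · exact h
    · exact h⟩
  loopless := ⟨by
    rintro (a | p) h
    · exact G.loopless.irrefl a h.1
    · exact h⟩

/-- A finite graph is 1-planar if it has a 1-planar embedding, given by an embedding of the
planarization, i.e. a planar rotation system, in which the two halves of a crossed edge are
opposite to each other at the crossing point. -/
def IsOnePlanar (G : SimpleGraph V) : Prop :=
  ∃ (C : CrossingPattern G) (σ : Equiv.Perm C.planarization.Dart),
    IsPlanarRotation C.planarization σ ∧
    ∀ (d : C.planarization.Dart) (p : C.pairs) (a b : V),
      d.fst = Sum.inr p → d.snd = Sum.inl a → s(a, b) ∈ p.1 → (σ (σ d)).snd = Sum.inl b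

/-- A graph with `n` vertices is optimal 1-planar if it is 1-planar and has `4 n - 8` edges,
which is the maximum for `n ≥ 3`. -/
def IsOptimalOnePlanar (G : SimpleGraph V) : Prop :=
  3 ≤ Nat.card V ∧ IsOnePlanar G ∧ G.edgeSet.ncard + 8 = 4 * Nat.card V

end Planarity

section Connectivity

variable {V : Type u}

/-- A finite graph is `k`-connected if it has more than `k` vertices and it stays connected after
the removal of fewer than `k` vertices. -/
def IsKConnected (k : ℕ) (G : SimpleGraph V) : Prop :=
  k < Nat.card V ∧ ∀ S : Finset V, S.card < k → (G.induce ((S : Set V)ᶜ)).Connected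

/-- There is a cycle `(a, b, c, d)` whose removal leaves a disconnected graph. -/
def HasSeparatingFourCycle (G : SimpleGraph V) : Prop :=
  ∃ a b c d : V, a ≠ c ∧ b ≠ d ∧ G.Adj a b ∧ G.Adj b c ∧ G.Adj c d ∧ G.Adj d a ∧
    ¬ (G.induce (({a, b, c, d} : Set V)ᶜ)).Preconnected

end Connectivity

section Reduction

/-- The extended wheel graph `XW_{2k}`: a cycle of length `2k` with all edges between vertices at
distance one or two on the cycle, and two non-adjacent poles adjacent to all cycle vertices. -/
def extendedWheel (k : ℕ) : SimpleGraph (ZMod (2 * k) ⊕ Fin 2) :=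
  SimpleGraph.fromRel fun a b => match a, b with
    | Sum.inl i, Sum.inl j => j = i + 1 ∨ j = i + 2
    | Sum.inl _, Sum.inr _ => True
    | Sum.inr _, _ => False

def IsExtendedWheel {V : Type u} (G : SimpleGraph V) : Prop :=
  ∃ k : ℕ, 3 ≤ k ∧ Nonempty (G ≃g extendedWheel k)

variable {V : Type u}

/-- An occurrence of the crossed star `CS` in `G`: a vertex `x` of degree six whose neighbours
`x₁, …, x₆` form the hexagon `(x₁, …, x₆)` together with the triangle `x₁, x₃, x₅`,
so that the three kites `(x, x₁, x₂, x₃)`, `(x, x₃, x₄, x₅)`, `(x, x₅, x₆, x₁)` meet at `x`.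
There may be further edges between the neighbours of `x`. -/
structure CrossedStar (G : SimpleGraph V) where
  (x x₁ x₂ x₃ x₄ x₅ x₆ : V)
  distinct : [x₁, x₂, x₃, x₄, x₅, x₆].Nodup
  neighbors : G.neighborSet x = {x₁, x₂, x₃, x₄, x₅, x₆}
  adj₁₂ : G.Adj x₁ x₂
  adj₂₃ : G.Adj x₂ x₃
  adj₃₄ : G.Adj x₃ x₄
  adj₄₅ : G.Adj x₄ x₅
  adj₅₆ : G.Adj x₅ x₆
  adj₆₁ : G.Adj x₆ x₁
  adj₁₃ : G.Adj x₁ x₃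
  adj₃₅ : G.Adj x₃ x₅
  adj₅₁ : G.Adj x₅ x₁

/-- The reduction `SR(x ↦ x₄)` is feasible if there is no blocking edge. (The other two targets
`x₂` and `x₆` are covered by rotating the labels.) -/
def CrossedStar.Feasible {G : SimpleGraph V} (M : CrossedStar G) : Prop :=
  ¬ G.Adj M.x₂ M.x₄ ∧ ¬ G.Adj M.x₆ M.x₄ ∧ ¬ G.Adj M.x₁ M.x₄

/-- The result of `SR(x ↦ x₄)`: the vertex `x` is removed and merged with `x₄`, so that
the three kites at `x` are replaced by the two adjacent kites `(x₁, x₂, x₃, x₄)` and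
`(x₁, x₄, x₅, x₆)`. The edge `x₃x₅` disappears with the kite `(x, x₃, x₄, x₅)`. -/
def CrossedStar.reduct {G : SimpleGraph V} (M : CrossedStar G) :
    SimpleGraph (({M.x} : Set V)ᶜ : Set V) :=
  (G.deleteEdges {s(M.x₃, M.x₅)} ⊔
    SimpleGraph.fromEdgeSet {s(M.x₄, M.x₁), s(M.x₄, M.x₂), s(M.x₄, M.x₆)}).induce ({M.x}ᶜ)

/-- `G → G'` by one feasible `SR`-reduction, up to isomorphism. -/
def SRStep {W : Type v} (G : SimpleGraph V) (G' : SimpleGraph W) : Prop :=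
  ∃ M : CrossedStar G, M.Feasible ∧ Nonempty (M.reduct ≃g G')

/-- `G →* H` by a finite sequence of feasible `SR`-reductions. -/
inductive SRReducesTo (G : SimpleGraph V) : ∀ {W : Type u}, SimpleGraph W → Prop
  | refl : SRReducesTo G G
  | step {W W' : Type u} {H : SimpleGraph W} {H' : SimpleGraph W'} :
      SRReducesTo G H → SRStep H H' → SRReducesTo G H'

end Reduction

end OptimalOnePlanar

/-!
In an optimal 1-planar drawing, Euler's formula leaves no slack: every face of the planarization
is a triangle with exactly one crossing as a vertex, so that `G` is a union of kites in which
every edge is either a side of two kites or a diagonal of one. A feasible reduction replaces the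
three kites at `x` by two, hence the reduced graphs are unions of kites as well, and this forces
all degrees to be at least six. A separation by at most four vertices therefore survives a
reduction: if `x` belongs to the cut, then `x₄` takes its place, and no side of the separation can
consist of `x` or `x₄` alone because of the degrees. An extended wheel, however, has no such
separation, since the cut has to contain both poles and, on the cycle, two consecutive vertices in
each of two gaps, which makes at least three cycle vertices.

That 5-connectivity is not preserved is shown by an example with 13 vertices. It is given by a
quadrangulation of the sphere, and both diagonals are drawn into each of its faces.
-/

namespace OptimalOnePlanar

/-! ### Kite covers -/

section KiteCover

variable {V : Type u} {W : Type v}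

/-- A quadrilateral, given by its vertices in cyclic order. The labelling is part of the data, so
that the same quadrilateral has eight representations. -/
abbrev Quad (V : Type u) : Type u := V × V × V × V

/-- The multiset of the four sides of a quadrilateral. -/
def sides : Quad V → Multiset (Sym2 V)
  | (a, b, c, d) => {s(a, b)} + {s(b, c)} + {s(c, d)} + {s(d, a)}

/-- The multiset of the two diagonals of a quadrilateral. -/
def diagonals : Quad V → Multiset (Sym2 V)
  | (a, b, c, d) => {s(a, c)} + {s(b, d)}

/-- The edges of the kite on a quadrilateral, where a side has weight one, because it is shared
with another kite, and a diagonal has weight two. -/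
def weight (q : Quad V) : Multiset (Sym2 V) := sides q + 2 • diagonals q

open Classical in
/-- `G` is the edge-disjoint union of the kites on the quadrilaterals in `P`, except that each side
is shared by two of them: every edge of `G` has total weight two, hence is either a side twice or
a diagonal once. -/
def IsKiteCover (G : SimpleGraph V) (P : Multiset (Quad V)) : Prop :=
  ∀ e, (P.bind weight).count e = if e ∈ G.edgeSet then 2 else 0

/-- The edges of `G` can be decomposed into kites which pairwise share sides. -/
def HasKiteCover (G : SimpleGraph V) : Prop := ∃ P, IsKiteCover G P

theorem weight_rotate (a b c d : V) : weight (b, c, d, a) = weight (a, b, c, d) := by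
  simp only [weight, sides, diagonals, Sym2.eq_swap (a := c) (b := a)]; abel

theorem weight_reflect (a b c d : V) : weight (b, a, d, c) = weight (a, b, c, d) := by
  simp only [weight, sides, diagonals, Sym2.eq_swap (a := b) (b := a),
    Sym2.eq_swap (a := a) (b := d), Sym2.eq_swap (a := d) (b := c),
    Sym2.eq_swap (a := c) (b := b)]; abel

theorem mem_sides {e : Sym2 V} {a b c d : V} :
    e ∈ sides (a, b, c, d) ↔ e = s(a, b) ∨ e = s(b, c) ∨ e = s(c, d) ∨ e = s(d, a) := by
  simp [sides]

theorem mem_diagonals {e : Sym2 V} {a b c d : V} :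
    e ∈ diagonals (a, b, c, d) ↔ e = s(a, c) ∨ e = s(b, d) := by
  simp [diagonals]

theorem bind_weight (P : Multiset (Quad V)) :
    P.bind weight = P.bind sides + 2 • P.bind diagonals := by
  simp only [two_nsmul, ← Multiset.bind_add]
  rfl

theorem exists_weight_eq_of_mem_sides {q : Quad V} {v w : V} (h : s(v, w) ∈ sides q) :
    ∃ c d, weight (v, w, c, d) = weight q := by
  obtain ⟨a, b, c, d⟩ := q
  have of_fst_side {a b c d : V} (h : s(v, w) = s(a, b)) :
      ∃ c' d', weight (v, w, c', d') = weight (a, b, c, d) := by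
    rcases Sym2.eq_iff.1 h with ⟨rfl, rfl⟩ | ⟨rfl, rfl⟩
    · exact ⟨_, _, rfl⟩
    · exact ⟨_, _, weight_reflect _ _ _ _⟩
  rcases mem_sides.1 h with h | h | h | h
  · exact of_fst_side h
  · rw [← weight_rotate]; exact of_fst_side h
  · rw [← weight_rotate, ← weight_rotate]; exact of_fst_side h
  · rw [weight_rotate]; exact of_fst_side h

theorem exists_weight_eq_of_mem_diagonals {q : Quad V} {v w : V} (h : s(v, w) ∈ diagonals q) :
    ∃ b d, weight (v, b, w, d) = weight q := by
  obtain ⟨a, b, c, d⟩ := q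
  have of_fst_diagonal {a b c d : V} (h : s(v, w) = s(a, c)) :
      ∃ b' d', weight (v, b', w, d') = weight (a, b, c, d) := by
    rcases Sym2.eq_iff.1 h with ⟨rfl, rfl⟩ | ⟨rfl, rfl⟩
    · exact ⟨_, _, rfl⟩
    · exact ⟨_, _, (weight_rotate _ _ _ _).trans (weight_rotate _ _ _ _)⟩
  rcases mem_diagonals.1 h with h | h
  · exact of_fst_diagonal h
  · rw [← weight_rotate]; exact of_fst_diagonal h

theorem exists_bind_weight_eq_cons {R : Multiset (Quad V)} {r : Quad V} {v w : V} (hr : r ∈ R)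
    (h : s(v, w) ∈ sides r) :
    ∃ c d R', ((v, w, c, d) ::ₘ R').bind weight = R.bind weight := by
  obtain ⟨c, d, hw⟩ := exists_weight_eq_of_mem_sides h
  obtain ⟨R', rfl⟩ := Multiset.exists_cons_of_mem hr
  exact ⟨c, d, R', by rw [Multiset.cons_bind, hw, Multiset.cons_bind]⟩

namespace IsKiteCover

variable {G : SimpleGraph V} {P R : Multiset (Quad V)} {q r : Quad V}

theorem congr (hK : IsKiteCover G P) (h : R.bind weight = P.bind weight) :
    IsKiteCover G R := fun e => by
  rw [h, hK e]

theorem relabel (hK : IsKiteCover G (q ::ₘ R)) (h : weight r = weight q) :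
    IsKiteCover G (r ::ₘ R) := by
  intro e
  rw [Multiset.cons_bind, h, ← Multiset.cons_bind, hK e]

open Classical in
theorem count_sides_add (hK : IsKiteCover G P) (e : Sym2 V) :
    (P.bind sides).count e + 2 * (P.bind diagonals).count e =
      if e ∈ G.edgeSet then 2 else 0 := by
  rw [← hK e, bind_weight, Multiset.count_add, Multiset.count_nsmul]

theorem mem_edgeSet_iff (hK : IsKiteCover G P) {e : Sym2 V} :
    e ∈ G.edgeSet ↔ e ∈ P.bind sides ∨ e ∈ P.bind diagonals := by
  classical
  have := hK.count_sides_add e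
  rw [← Multiset.count_pos, ← Multiset.count_pos]
  split_ifs at this with he <;> simp only [he, true_iff, false_iff] <;> omega

theorem nodup_diagonals (hK : IsKiteCover G P) : (P.bind diagonals).Nodup := by
  classical
  rw [Multiset.nodup_iff_count_le_one]
  intro e
  have := hK.count_sides_add e
  split_ifs at this <;> omega

theorem notMem_bind_diagonals (hK : IsKiteCover G P) {e : Sym2 V} (hs : e ∈ P.bind sides) :
    e ∉ P.bind diagonals := by
  classical
  intro hd
  have := hK.count_sides_add e
  rw [← Multiset.count_pos] at hs hd
  split_ifs at this <;> omega

theorem adj_of_mem (hK : IsKiteCover G P) {a b c d : V} (h : (a, b, c, d) ∈ P) :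
    G.Adj a b ∧ G.Adj b c ∧ G.Adj c d ∧ G.Adj d a ∧ G.Adj a c ∧ G.Adj b d := by
  have side {v w : V} (hs : s(v, w) ∈ sides (a, b, c, d)) : G.Adj v w :=
    hK.mem_edgeSet_iff.2 (Or.inl (Multiset.mem_bind.2 ⟨_, h, hs⟩))
  have diagonal {v w : V} (hd : s(v, w) ∈ diagonals (a, b, c, d)) : G.Adj v w :=
    hK.mem_edgeSet_iff.2 (Or.inr (Multiset.mem_bind.2 ⟨_, h, hd⟩))
  refine ⟨side ?_, side ?_, side ?_, side ?_, diagonal ?_, diagonal ?_⟩ <;>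
    simp [mem_sides, mem_diagonals]

theorem nodup_sides (hK : IsKiteCover G P) (hq : q ∈ P) : (sides q).Nodup := by
  obtain ⟨a, b, c, d⟩ := q
  obtain ⟨hab, hbc, hcd, hda, hac, hbd⟩ := hK.adj_of_mem hq
  simp only [sides, Multiset.singleton_add, Multiset.cons_add, Multiset.nodup_cons,
    Multiset.mem_cons, Multiset.mem_singleton, Multiset.nodup_singleton, Sym2.eq_iff]
  grind [hab.ne, hbc.ne, hcd.ne, hda.ne, hac.ne, hbd.ne]

theorem exists_mem_sides (hK : IsKiteCover G (q ::ₘ R)) {e : Sym2 V} (he : e ∈ sides q) :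
    ∃ r ∈ R, e ∈ sides r := by
  classical
  have once : (sides q).count e = 1 :=
    Multiset.count_eq_one_of_mem (hK.nodup_sides (Multiset.mem_cons_self q R)) he
  have total := hK.count_sides_add e
  rw [Multiset.cons_bind, Multiset.count_add, once] at total
  rw [← Multiset.mem_bind, ← Multiset.count_pos]
  split_ifs at total <;> omega

theorem exists_three_kites {v b₀ c₀ b₁ : V} (hK : IsKiteCover G ((v, b₀, c₀, b₁) ::ₘ R)) :
    ∃ c₁ b₂ c₂ b₃ R', IsKiteCover G
      ((v, b₀, c₀, b₁) ::ₘ (v, b₁, c₁, b₂) ::ₘ (v, b₂, c₂, b₃) ::ₘ R') := by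
  obtain ⟨r₁, hr₁, h₁⟩ := hK.exists_mem_sides (e := s(v, b₁))
    (mem_sides.2 (by simp [Sym2.eq_swap]))
  obtain ⟨c₁, b₂, R₁, hR₁⟩ := exists_bind_weight_eq_cons hr₁ h₁
  replace hK : IsKiteCover G ((v, b₁, c₁, b₂) ::ₘ (v, b₀, c₀, b₁) ::ₘ R₁) :=
    hK.congr (by simp only [Multiset.cons_bind, ← hR₁, add_left_comm])
  have new_side : s(v, b₂) ∉ sides (v, b₀, c₀, b₁) := by
    obtain ⟨hvb₀, -, -, hb₁v, -, -⟩ :=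
      hK.adj_of_mem (a := v) (b := b₀) (c := c₀) (d := b₁) (by simp)
    have hb₁b₂ :=
      (hK.adj_of_mem (a := v) (b := b₁) (c := c₁) (d := b₂) (by simp)).2.2.2.2.2.ne
    have hb₂b₀ : b₂ ≠ b₀ := by
      have := hK.nodup_diagonals
      rintro rfl
      simp [diagonals, Sym2.eq_swap] at this
    simp only [mem_sides, Sym2.eq_iff]
    grind [hvb₀.ne, hb₁v.ne]
  obtain ⟨r₂, hr₂, h₂⟩ := hK.exists_mem_sides (e := s(v, b₂))
    (mem_sides.2 (by simp [Sym2.eq_swap]))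
  obtain rfl | hr₂ := Multiset.mem_cons.1 hr₂
  · exact absurd h₂ new_side
  obtain ⟨c₂, b₃, R₂, hR₂⟩ := exists_bind_weight_eq_cons hr₂ h₂
  exact ⟨c₁, b₂, c₂, b₃, R₂, hK.congr (by simp only [Multiset.cons_bind, ← hR₂, add_left_comm])⟩

section ThreeKites

variable {v b₀ c₀ b₁ c₁ b₂ c₂ b₃ : V}

theorem nodup_of_three_kites (hK : IsKiteCover G
    ((v, b₀, c₀, b₁) ::ₘ (v, b₁, c₁, b₂) ::ₘ (v, b₂, c₂, b₃) ::ₘ R)) :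
    [b₀, c₀, b₁, c₁, b₂, c₂].Nodup ∧ b₃ ∉ [c₀, b₁, c₁, b₂, c₂] := by
  have b_ne_c : ∀ b ∈ [b₀, b₁, b₂, b₃], ∀ c ∈ [c₀, c₁, c₂], b ≠ c := by
    rintro b hb _ hc rfl
    refine hK.notMem_bind_diagonals (e := s(v, b)) ?_ ?_
    · simp only [List.mem_cons, List.not_mem_nil, or_false] at hb
      rcases hb with rfl | rfl | rfl | rfl <;> simp [mem_sides]
    · simp only [List.mem_cons, List.not_mem_nil, or_false] at hc
      rcases hc with rfl | rfl | rfl <;> simp [mem_diagonals]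
  have hb₀b₁ := (hK.adj_of_mem (a := v) (b := b₀) (c := c₀) (d := b₁) (by simp)).2.2.2.2.2.ne
  have hb₁b₂ := (hK.adj_of_mem (a := v) (b := b₁) (c := c₁) (d := b₂) (by simp)).2.2.2.2.2.ne
  have hb₂b₃ := (hK.adj_of_mem (a := v) (b := b₂) (c := c₂) (d := b₃) (by simp)).2.2.2.2.2.ne
  have diagonals_ne := hK.nodup_diagonals
  simp only [Multiset.cons_bind, diagonals, Multiset.singleton_add, Multiset.cons_add,
    Multiset.nodup_cons, Multiset.mem_cons, not_or, Sym2.eq_iff] at diagonals_ne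
  simp only [List.nodup_cons, List.mem_cons, List.not_mem_nil,
    List.nodup_nil] at b_ne_c ⊢
  clear hK
  grind

theorem subset_neighborSet_of_three_kites (hK : IsKiteCover G
    ((v, b₀, c₀, b₁) ::ₘ (v, b₁, c₁, b₂) ::ₘ (v, b₂, c₂, b₃) ::ₘ R)) :
    {u | u ∈ [b₀, c₀, b₁, c₁, b₂, c₂]} ∪ {b₃} ⊆ G.neighborSet v := by
  obtain ⟨hb₀, -, -, -, hc₀, -⟩ := hK.adj_of_mem (a := v) (b := b₀) (c := c₀) (d := b₁) (by simp)
  obtain ⟨hb₁, -, -, -, hc₁, -⟩ := hK.adj_of_mem (a := v) (b := b₁) (c := c₁) (d := b₂) (by simp)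
  obtain ⟨hb₂, -, -, hb₃, hc₂, -⟩ := hK.adj_of_mem (a := v) (b := b₂) (c := c₂) (d := b₃) (by simp)
  rintro u (hu | rfl)
  · simp only [Set.mem_ofPred_eq, List.mem_cons, List.not_mem_nil, or_false] at hu
    rcases hu with rfl | rfl | rfl | rfl | rfl | rfl <;> assumption
  · exact hb₃.symm

end ThreeKites

theorem exists_cons_of_adj (hK : IsKiteCover G P) {v w : V} (h : G.Adj v w) :
    ∃ b c d R, IsKiteCover G ((v, b, c, d) ::ₘ R) ∧ (w = b ∨ w = c) := by
  rcases hK.mem_edgeSet_iff.1 ((G.mem_edgeSet).2 h) with h | h <;>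
    obtain ⟨q, hq, hw⟩ := Multiset.mem_bind.1 h <;>
    obtain ⟨R, rfl⟩ := Multiset.exists_cons_of_mem hq
  · obtain ⟨c, d, h⟩ := exists_weight_eq_of_mem_sides hw
    exact ⟨w, c, d, R, hK.relabel h, Or.inl rfl⟩
  · obtain ⟨b, d, h⟩ := exists_weight_eq_of_mem_diagonals hw
    exact ⟨b, w, d, R, hK.relabel h, Or.inr rfl⟩

theorem six_le_encard_neighborSet (hK : IsKiteCover G P) {v w : V} (h : G.Adj v w) :
    6 ≤ (G.neighborSet v).encard := by
  classical
  obtain ⟨b₀, c₀, b₁, R, hK, -⟩ := hK.exists_cons_of_adj h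
  obtain ⟨c₁, b₂, c₂, b₃, R', hK⟩ := hK.exists_three_kites
  have hsub := Set.subset_union_left.trans hK.subset_neighborSet_of_three_kites
  have hcard := List.toFinset_card_of_nodup hK.nodup_of_three_kites.1
  rw [← List.coe_toFinset] at hsub
  calc (6 : ℕ∞) = ([b₀, c₀, b₁, c₁, b₂, c₂].toFinset : Set V).encard := by
        rw [Set.encard_coe_eq_coe_finsetCard, hcard]; rfl
    _ ≤ (G.neighborSet v).encard := Set.encard_le_encard hsub

theorem exists_closed_three_kites {x b₀ c₀ b₁ : V} (hK : IsKiteCover G ((x, b₀, c₀, b₁) ::ₘ R))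
    (hx : (G.neighborSet x).encard = 6) :
    ∃ c₁ b₂ c₂ R', IsKiteCover G
      ((x, b₀, c₀, b₁) ::ₘ (x, b₁, c₁, b₂) ::ₘ (x, b₂, c₂, b₀) ::ₘ R') ∧
      G.neighborSet x = {u | u ∈ [b₀, c₀, b₁, c₁, b₂, c₂]} := by
  classical
  obtain ⟨c₁, b₂, c₂, b₃, R', hK⟩ := hK.exists_three_kites
  obtain ⟨hnodup, hb₃⟩ := hK.nodup_of_three_kites
  obtain ⟨hsub, hb₃x⟩ := Set.union_subset_iff.1 hK.subset_neighborSet_of_three_kites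
  have hN : {u | u ∈ [b₀, c₀, b₁, c₁, b₂, c₂]} = G.neighborSet x := by
    rw [← List.coe_toFinset] at hsub ⊢
    refine Set.Finite.eq_of_subset_of_encard_le (Finset.finite_toSet _) hsub ?_
    rw [hx, Set.encard_coe_eq_coe_finsetCard, List.toFinset_card_of_nodup hnodup]
    rfl
  obtain rfl : b₃ = b₀ := by
    rw [← hN, Set.singleton_subset_iff] at hb₃x
    exact (List.mem_cons.1 hb₃x).resolve_right hb₃
  exact ⟨c₁, b₂, c₂, R', hK, hN.symm⟩

theorem exchange {H : SimpleGraph V} {Q Q' : Multiset (Quad V)} {A B : Multiset (Sym2 V)}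
    (hK : IsKiteCover G (Q + R)) (hw : Q'.bind weight + 2 • A = Q.bind weight + 2 • B)
    (hA : A.Nodup) (hB : B.Nodup) (hAG : ∀ e ∈ A, e ∈ G.edgeSet) (hBG : ∀ e ∈ B, e ∉ G.edgeSet)
    (hH : ∀ e, e ∈ H.edgeSet ↔ e ∈ G.edgeSet ∧ e ∉ A ∨ e ∈ B) :
    IsKiteCover H (Q' + R) := by
  classical
  intro e
  have hold := hK e
  have hnew := congr_arg (Multiset.count e) hw
  simp only [Multiset.add_bind, Multiset.count_add, Multiset.count_nsmul,
    Multiset.count_eq_of_nodup hA, Multiset.count_eq_of_nodup hB] at hold hnew ⊢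
  have := hAG e
  have := hBG e
  have := hH e
  grind

end IsKiteCover

theorem HasKiteCover.of_embedding {G : SimpleGraph V} {H : SimpleGraph W} (h : HasKiteCover G)
    (f : H ↪g G) (hf : ∀ v w, G.Adj v w → v ∈ Set.range f) : HasKiteCover H := by
  classical
  obtain ⟨P, hK⟩ := h
  let g (q : Quad W) : Quad V := (f q.1, f q.2.1, f q.2.2.1, f q.2.2.2)
  have exists_lift : ∀ q ∈ P, ∃ q', g q' = q := by
    rintro ⟨a, b, c, d⟩ hq
    obtain ⟨hab, hbc, hcd, hda, -, -⟩ := hK.adj_of_mem hq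
    obtain ⟨a, rfl⟩ := hf _ _ hab
    obtain ⟨b, rfl⟩ := hf _ _ hbc
    obtain ⟨c, rfl⟩ := hf _ _ hcd
    obtain ⟨d, rfl⟩ := hf _ _ hda
    exact ⟨(a, b, c, d), rfl⟩
  obtain ⟨P, rfl⟩ : ∃ P' : Multiset (Quad W), P'.map g = P := by
    choose l hl using exists_lift
    exact ⟨P.attach.map fun q : {q // q ∈ P} => l q q.2, by
      rw [Multiset.map_map]
      exact (Multiset.map_congr rfl fun (q : {q // q ∈ P}) _ => hl q q.2).trans P.attach_map_val⟩
  have hw : (P.map g).bind weight = (P.bind weight).map (Sym2.map f) := by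
    rw [Multiset.bind_map, Multiset.map_bind]
    exact Multiset.bind_congr fun q _ => by simp [g, weight, sides, diagonals, two_nsmul]
  refine ⟨P, fun e => ?_⟩
  rw [← Multiset.count_map_eq_count' (Sym2.map f) _ (Sym2.map.injective f.injective), ← hw, hK]
  simp only [← f.map_mem_edgeSet_iff]

theorem HasKiteCover.of_iso {G : SimpleGraph V} {H : SimpleGraph W} (e : G ≃g H)
    (h : HasKiteCover G) : HasKiteCover H :=
  h.of_embedding e.symm.toEmbedding fun v _ _ => e.symm.surjective v

end KiteCover

/-! ### Reductions of kite covers -/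

section Reduction

variable {V : Type u} {G : SimpleGraph V}

namespace CrossedStar

variable (M : CrossedStar G)

theorem neighborSet_eq : G.neighborSet M.x = {v | v ∈ [M.x₁, M.x₂, M.x₃, M.x₄, M.x₅, M.x₆]} := by
  rw [M.neighbors]
  ext v
  simp

theorem encard_neighborSet : (G.neighborSet M.x).encard = 6 := by
  classical
  rw [M.neighborSet_eq, ← List.coe_toFinset, Set.encard_coe_eq_coe_finsetCard,
    List.toFinset_card_of_nodup M.distinct]
  rfl

theorem reduct_adj_iff {a b : (({M.x} : Set V)ᶜ : Set V)} : M.reduct.Adj a b ↔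
    G.Adj a b ∧ s(a.1, b.1) ≠ s(M.x₃, M.x₅) ∨
      (s(a.1, b.1) ∈ (fun v => s(M.x₄, v)) '' {M.x₁, M.x₂, M.x₆}) ∧ a.1 ≠ b.1 := by
  simp only [reduct, SimpleGraph.comap_adj, SimpleGraph.sup_adj, SimpleGraph.deleteEdges_adj,
    SimpleGraph.fromEdgeSet_adj, Set.mem_singleton_iff, Function.Embedding.subtype_apply, ne_eq,
    Set.image_insert_eq, Set.image_singleton]

theorem mem_edgeSet_map_reduct {e : Sym2 V} :
    e ∈ (M.reduct.map (Function.Embedding.subtype _)).edgeSet ↔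
      (e ∈ G.edgeSet ∧ M.x ∉ e ∧ e ≠ s(M.x₃, M.x₅)) ∨
        e ∈ (fun v => s(M.x₄, v)) '' {M.x₁, M.x₂, M.x₆} := by
  have new_edge {a b : V} (h : s(a, b) ∈ (fun v => s(M.x₄, v)) '' {M.x₁, M.x₂, M.x₆}) :
      a ≠ b ∧ M.x ≠ a ∧ M.x ≠ b := by
    have hx {v : V} (hv : v ∈ G.neighborSet M.x) : M.x ≠ v := hv.ne
    have hdistinct := M.distinct
    rw [M.neighborSet_eq] at hx
    simp only [Set.image_insert_eq, Set.image_singleton, Set.mem_insert_iff,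
      Set.mem_singleton_iff, Sym2.eq_iff] at h
    simp only [List.nodup_cons, List.mem_cons, Set.mem_ofPred_eq] at hdistinct hx
    grind
  induction e using Sym2.ind with | _ a b => ?_
  simp only [SimpleGraph.mem_edgeSet, SimpleGraph.map_adj, Function.Embedding.subtype_apply,
    Sym2.mem_iff, not_or]
  constructor
  · rintro ⟨⟨a, ha⟩, ⟨b, hb⟩, h, rfl, rfl⟩
    have hxa : M.x ≠ a := fun h => ha h.symm
    have hxb : M.x ≠ b := fun h => hb h.symm
    exact (M.reduct_adj_iff.1 h).imp (fun h => ⟨h.1, ⟨hxa, hxb⟩, h.2⟩) And.left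
  · rintro (⟨h, ⟨ha, hb⟩, h₃₅⟩ | h)
    · exact ⟨⟨a, Ne.symm ha⟩, ⟨b, Ne.symm hb⟩, M.reduct_adj_iff.2 (Or.inl ⟨h, h₃₅⟩), rfl, rfl⟩
    · obtain ⟨hab, ha, hb⟩ := new_edge h
      exact ⟨⟨a, ha.symm⟩, ⟨b, hb.symm⟩, M.reduct_adj_iff.2 (Or.inr ⟨h, hab⟩), rfl, rfl⟩

theorem Feasible.not_adj {M : CrossedStar G} (hM : M.Feasible) {v : V}
    (hv : v ∈ ({M.x₁, M.x₂, M.x₆} : Set V)) : ¬ G.Adj v M.x₄ := by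
  obtain ⟨h₂, h₆, h₁⟩ := hM
  rcases hv with rfl | rfl | rfl <;> assumption

end CrossedStar

theorem nodup_spokes {s : Multiset V} (hs : s.Nodup) (x : V) : (s.map (s(x, ·))).Nodup :=
  hs.map fun _ _ h => Sym2.congr_right.1 h

theorem mem_spokes_iff {s : Multiset V} {x : V} (hN : ∀ v, G.Adj x v ↔ v ∈ s) {e : Sym2 V}
    (he : e ∈ G.edgeSet) : e ∈ s.map (s(x, ·)) ↔ x ∈ e := by
  rw [Multiset.mem_map]
  constructor
  · rintro ⟨v, -, rfl⟩
    exact Sym2.mem_mk_left x v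
  · intro hx
    obtain ⟨v, rfl⟩ := Sym2.mem_iff_exists.1 hx
    exact ⟨v, (hN v).1 he, rfl⟩

theorem bind_weight_merge (x y b₀ b₁ c₁ b₂ c₂ : V) :
    ({(b₂, c₂, b₀, y)} + {(b₂, y, b₁, c₁)} : Multiset (Quad V)).bind weight +
        2 • (s(b₀, b₁) ::ₘ ({b₀, y, b₁, c₁, b₂, c₂} : Multiset V).map (s(x, ·))) =
      ({(x, b₀, y, b₁)} + {(x, b₁, c₁, b₂)} + {(x, b₂, c₂, b₀)} : Multiset (Quad V)).bind weight +
        2 • ({b₂, c₁, c₂} : Multiset V).map (s(y, ·)) := by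
  simp only [Multiset.add_bind, Multiset.singleton_bind, weight, sides, diagonals,
    Multiset.insert_eq_cons, ← Multiset.singleton_add, Multiset.map_add, Multiset.map_singleton,
    Sym2.eq_swap (a := b₁) (b := x), Sym2.eq_swap (a := b₂) (b := x),
    Sym2.eq_swap (a := b₀) (b := x), Sym2.eq_swap (a := b₂) (b := y),
    Sym2.eq_swap (a := c₂) (b := y), Sym2.eq_swap (a := b₂) (b := b₁)]
  abel

namespace IsKiteCover

variable {P R : Multiset (Quad V)}

/-- If `x x₄` were a side of kites, then `x₄` would be adjacent to four of the five other neighbours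
of `x`. -/
theorem exists_opposite_of_feasible (hK : IsKiteCover G P) {M : CrossedStar G}
    (hM : M.Feasible) : ∃ b₀ b₁ R, IsKiteCover G ((M.x, b₀, M.x₄, b₁) ::ₘ R) := by
  have hx₄ : G.Adj M.x M.x₄ := M.neighborSet_eq.ge (by simp)
  obtain ⟨b₀, y, b₁, R, hK, rfl | rfl⟩ := hK.exists_cons_of_adj hx₄
  · obtain ⟨c₁, b₂, c₂, R', hK, hN⟩ := hK.exists_closed_three_kites M.encard_neighborSet
    obtain ⟨-, hy, -, -, -, hb₁⟩ :=
      hK.adj_of_mem (a := M.x) (b := M.x₄) (c := y) (d := b₁) (by simp)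
    obtain ⟨-, -, hc₂, -, -, hb₂⟩ :=
      hK.adj_of_mem (a := M.x) (b := b₂) (c := c₂) (d := M.x₄) (by simp)
    have eq_c₁ {v : V} (hv : v ∈ ({M.x₁, M.x₂, M.x₆} : Set V)) : v = c₁ := by
      have hvx : v ∈ {u | u ∈ [M.x₄, y, b₁, c₁, b₂, c₂]} := by
        rw [← hN, M.neighborSet_eq]
        rcases hv with rfl | rfl | rfl <;> simp
      have hv₄ : v ≠ M.x₄ := by
        have := M.distinct
        rcases hv with rfl | rfl | rfl <;> grind
      have hnot_adj := hM.not_adj hv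
      simp only [List.mem_cons, List.not_mem_nil, or_false, Set.mem_ofPred_eq] at hvx
      rcases hvx with rfl | rfl | rfl | rfl | rfl | rfl
      · exact absurd rfl hv₄
      · exact absurd hy.symm hnot_adj
      · exact absurd hb₁.symm hnot_adj
      · rfl
      · exact absurd hb₂ hnot_adj
      · exact absurd hc₂ hnot_adj
    have hx₁x₂ : M.x₁ = M.x₂ := (eq_c₁ (by simp)).trans (eq_c₁ (by simp)).symm
    exact absurd hx₁x₂ M.adj₁₂.ne
  · exact ⟨b₀, b₁, R, hK⟩

theorem exists_three_kites_of_feasible (hK : IsKiteCover G P) {M : CrossedStar G}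
    (hM : M.Feasible) : ∃ b₀ b₁ c₁ b₂ c₂ R,
      IsKiteCover G ((M.x, b₀, M.x₄, b₁) ::ₘ (M.x, b₁, c₁, b₂) ::ₘ (M.x, b₂, c₂, b₀) ::ₘ R) ∧
      (∀ v, G.Adj M.x v ↔ v ∈ ({b₀, M.x₄, b₁, c₁, b₂, c₂} : Multiset V)) ∧
      s(M.x₃, M.x₅) = s(b₀, b₁) ∧
      ∀ v, v ∈ ({M.x₁, M.x₂, M.x₆} : Set V) ↔ v ∈ ({b₂, c₁, c₂} : Multiset V) := by
  obtain ⟨b₀, b₁, R, hK⟩ := hK.exists_opposite_of_feasible hM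
  obtain ⟨c₁, b₂, c₂, R', hK, hN⟩ := hK.exists_closed_three_kites M.encard_neighborSet
  refine ⟨b₀, b₁, c₁, b₂, c₂, R', hK, fun v => Set.ext_iff.1 hN v, ?_⟩
  obtain ⟨-, hb₀, hb₁, -, -, hb₀b₁⟩ :=
    hK.adj_of_mem (a := M.x) (b := b₀) (c := M.x₄) (d := b₁) (by simp)
  have hdistinct := M.distinct
  have hdistinct' := hK.nodup_of_three_kites.1
  have labels (v : V) : v ∈ [b₀, M.x₄, b₁, c₁, b₂, c₂] ↔
      v ∈ [M.x₁, M.x₂, M.x₃, M.x₄, M.x₅, M.x₆] := by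
    have := hN.symm.trans M.neighborSet_eq
    simpa using Set.ext_iff.1 this v
  have eq_x₃_or_x₅ {v : V} (hv : v ∈ [b₀, M.x₄, b₁, c₁, b₂, c₂]) (hadj : G.Adj v M.x₄) :
      v = M.x₃ ∨ v = M.x₅ := by
    have := hM.not_adj (v := v)
    have := hadj.ne
    have := (labels v).1 hv
    simp only [List.mem_cons, Set.mem_insert_iff, Set.mem_singleton_iff] at *
    tauto
  have h₃₅ : s(M.x₃, M.x₅) = s(b₀, b₁) := by
    have := eq_x₃_or_x₅ (by simp) hb₀
    have := eq_x₃_or_x₅ (by simp) hb₁.symm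
    have := hb₀b₁.ne
    grind [Sym2.eq_iff]
  refine ⟨h₃₅, fun v => ?_⟩
  have := labels v
  rw [Sym2.eq_iff] at h₃₅
  clear hK hN labels eq_x₃_or_x₅
  simp only [List.nodup_cons, List.mem_cons, Set.mem_insert_iff, Set.mem_singleton_iff,
    Multiset.insert_eq_cons, Multiset.mem_cons, Multiset.mem_singleton] at *
  grind

variable {H : SimpleGraph V} {x y b₀ b₁ b₂ c₁ c₂ : V}

/-- Moving `x` to `y` turns the three kites at `x` into two kites which share the side `yb₂`. -/
theorem merge
    (hK : IsKiteCover G ((x, b₀, y, b₁) ::ₘ (x, b₁, c₁, b₂) ::ₘ (x, b₂, c₂, b₀) ::ₘ R))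
    (hN : ∀ v, G.Adj x v ↔ v ∈ ({b₀, y, b₁, c₁, b₂, c₂} : Multiset V))
    (hy : ∀ v ∈ ({b₂, c₁, c₂} : Multiset V), ¬ G.Adj v y)
    (hH : ∀ e, e ∈ H.edgeSet ↔ (e ∈ G.edgeSet ∧ x ∉ e ∧ e ≠ s(b₀, b₁)) ∨
      e ∈ ({b₂, c₁, c₂} : Multiset V).map (s(y, ·))) :
    IsKiteCover H ((b₂, c₂, b₀, y) ::ₘ (b₂, y, b₁, c₁) ::ₘ R) := by
  have hnodup : ({b₀, y, b₁, c₁, b₂, c₂} : Multiset V).Nodup :=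
    Multiset.coe_nodup.2 hK.nodup_of_three_kites.1
  have hnodup' : ({b₂, c₁, c₂} : Multiset V).Nodup := by
    simp only [Multiset.insert_eq_cons, Multiset.nodup_cons, Multiset.mem_cons,
      Multiset.mem_singleton, Multiset.nodup_singleton] at hnodup ⊢
    tauto
  have hb₀b₁ : G.Adj b₀ b₁ :=
    (hK.adj_of_mem (a := x) (b := b₀) (c := y) (d := b₁) (by simp)).2.2.2.2.2
  suffices IsKiteCover H ({(b₂, c₂, b₀, y)} + {(b₂, y, b₁, c₁)} + R) by
    simpa only [Multiset.singleton_add, Multiset.cons_add] using this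
  refine exchange (Q := {(x, b₀, y, b₁)} + {(x, b₁, c₁, b₂)} + {(x, b₂, c₂, b₀)})
    (A := s(b₀, b₁) ::ₘ ({b₀, y, b₁, c₁, b₂, c₂} : Multiset V).map (s(x, ·)))
    (B := ({b₂, c₁, c₂} : Multiset V).map (s(y, ·)))
    (by simpa only [Multiset.singleton_add, Multiset.cons_add] using hK)
    (bind_weight_merge x y b₀ b₁ c₁ b₂ c₂) ?_ (nodup_spokes hnodup' y) ?_ ?_ fun e => ?_
  · refine Multiset.nodup_cons.2 ⟨fun h => ?_, nodup_spokes hnodup x⟩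
    have hx : x ∈ s(b₀, b₁) := (mem_spokes_iff hN hb₀b₁).1 h
    have hb₀ : G.Adj x b₀ := (hN b₀).2 (by simp)
    have hb₁ : G.Adj x b₁ := (hN b₁).2 (by simp)
    exact (Sym2.mem_iff.1 hx).elim hb₀.ne hb₁.ne
  · rintro e he
    rcases Multiset.mem_cons.1 he with rfl | he
    · exact hb₀b₁
    · obtain ⟨v, hv, rfl⟩ := Multiset.mem_map.1 he
      exact (hN v).2 hv
  · rintro e he
    obtain ⟨v, hv, rfl⟩ := Multiset.mem_map.1 he
    exact fun h => hy v hv (SimpleGraph.Adj.symm h)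
  · have := mem_spokes_iff hN (e := e)
    rw [hH, Multiset.mem_cons]
    tauto

end IsKiteCover

theorem HasKiteCover.reduct (h : HasKiteCover G) {M : CrossedStar G} (hM : M.Feasible) :
    HasKiteCover M.reduct := by
  obtain ⟨P, hK⟩ := h
  obtain ⟨b₀, b₁, c₁, b₂, c₂, R, hK, hN, h₃₅, hnew⟩ := hK.exists_three_kites_of_feasible hM
  have hmerge : HasKiteCover (M.reduct.map (Function.Embedding.subtype _)) :=
    ⟨_, hK.merge hN (fun v hv => hM.not_adj ((hnew v).2 hv)) fun e => by
      simp only [M.mem_edgeSet_map_reduct, h₃₅, Set.mem_image, Multiset.mem_map, hnew]⟩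
  refine hmerge.of_embedding (SimpleGraph.Embedding.map _ _) ?_
  rintro _ _ ⟨-, v, -, -, rfl, -⟩
  exact ⟨v, rfl⟩

end Reduction

/-! ### Separations -/

section Separation

variable {V : Type u} {W : Type v} {G : SimpleGraph V} {A B : Set V} {T : Finset V}

/-- The finite set `T` separates the two nonempty sides `A` and `B`, which together consist of all
the other vertices. -/
structure IsSeparation (G : SimpleGraph V) (A B : Set V) (T : Finset V) : Prop where
  left_nonempty : A.Nonempty
  right_nonempty : B.Nonempty
  disjoint : Disjoint A B
  union_eq : A ∪ B = (T : Set V)ᶜ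
  not_adj : ∀ a ∈ A, ∀ b ∈ B, ¬ G.Adj a b

/-- `G` can be disconnected by the removal of at most `k` vertices. -/
def HasSeparation (k : ℕ) (G : SimpleGraph V) : Prop :=
  ∃ (A B : Set V) (T : Finset V), IsSeparation G A B T ∧ T.card ≤ k

namespace IsSeparation

theorem symm (h : IsSeparation G A B T) : IsSeparation G B A T where
  left_nonempty := h.right_nonempty
  right_nonempty := h.left_nonempty
  disjoint := h.disjoint.symm
  union_eq := (Set.union_comm B A).trans h.union_eq
  not_adj b hb a ha hba := h.not_adj a ha b hb hba.symm

theorem mem_or_mem_iff (h : IsSeparation G A B T) {v : V} : v ∈ A ∨ v ∈ B ↔ v ∉ T :=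
  Set.ext_iff.1 h.union_eq v

theorem mem_left_of_adj (h : IsSeparation G A B T) {a v : V} (ha : a ∈ A) (hav : G.Adj a v)
    (hv : v ∉ T) : v ∈ A :=
  (h.mem_or_mem_iff.2 hv).resolve_right fun hvB => h.not_adj a ha v hvB hav

theorem of_iso {H : SimpleGraph W} (e : G ≃g H) (h : IsSeparation G A B T) :
    IsSeparation H (e.symm ⁻¹' A) (e.symm ⁻¹' B) (T.map e.toEmbedding.toEmbedding) where
  left_nonempty := h.left_nonempty.preimage e.symm.surjective
  right_nonempty := h.right_nonempty.preimage e.symm.surjective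
  disjoint := h.disjoint.preimage _
  union_eq := by
    rw [← Set.preimage_union, h.union_eq, Set.preimage_compl, Finset.coe_map]
    congr 1
    exact (e.toEquiv.image_eq_preimage_symm T).symm
  not_adj a ha b hb hab := h.not_adj _ ha _ hb (e.symm.map_adj_iff.2 hab)

end IsSeparation

theorem not_preconnected_iff_exists_isSeparation :
    ¬ (G.induce (T : Set V)ᶜ).Preconnected ↔ ∃ A B, IsSeparation G A B T := by
  constructor
  · intro h
    simp only [SimpleGraph.Preconnected, not_forall] at h
    obtain ⟨v, w, hvw⟩ := h
    refine ⟨Subtype.val '' {z | (G.induce (T : Set V)ᶜ).Reachable v z},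
      Subtype.val '' {z | (G.induce (T : Set V)ᶜ).Reachable v z}ᶜ,
      ⟨v, v, SimpleGraph.Reachable.refl v, rfl⟩, ⟨w, w, hvw, rfl⟩, ?_, ?_, ?_⟩
    · exact Set.disjoint_image_of_injective Subtype.val_injective disjoint_compl_right
    · rw [← Set.image_union, Set.union_compl_self, Set.image_univ, Subtype.range_coe]
    · rintro _ ⟨a, ha, rfl⟩ _ ⟨b, hb, rfl⟩ hab
      exact hb (ha.trans (SimpleGraph.Adj.reachable (G := G.induce _) hab))
  · rintro ⟨A, B, h⟩ hconn
    obtain ⟨a, ha⟩ := h.left_nonempty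
    obtain ⟨b, hb⟩ := h.right_nonempty
    obtain ⟨p⟩ := hconn ⟨a, h.mem_or_mem_iff.1 (Or.inl ha)⟩ ⟨b, h.mem_or_mem_iff.1 (Or.inr hb)⟩
    obtain ⟨d, -, hd, hd'⟩ := p.exists_boundary_dart (Subtype.val ⁻¹' A) ha
      (h.disjoint.notMem_of_mem_right hb)
    exact hd' (h.mem_left_of_adj hd d.adj d.snd.2)

theorem HasSeparation.of_iso {k : ℕ} {H : SimpleGraph W} (e : G ≃g H) (h : HasSeparation k G) :
    HasSeparation k H := by
  obtain ⟨A, B, T, h, hT⟩ := h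
  exact ⟨_, _, _, h.of_iso e, by rwa [Finset.card_map]⟩

theorem HasSeparation.not_isKConnected {k l : ℕ} (h : HasSeparation k G) (hkl : k < l) :
    ¬ IsKConnected l G := by
  obtain ⟨A, B, T, h, hT⟩ := h
  intro hconn
  exact not_preconnected_iff_exists_isSeparation.2 ⟨A, B, h⟩
    (hconn.2 T (hT.trans_lt hkl)).preconnected

theorem HasSeparatingFourCycle.hasSeparation (h : HasSeparatingFourCycle G) :
    HasSeparation 4 G := by
  classical
  obtain ⟨a, b, c, d, -, -, -, -, -, -, h⟩ := h
  rw [show ({a, b, c, d} : Set V) = ({a, b, c, d} : Finset V) by simp] at h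
  obtain ⟨A, B, h⟩ := not_preconnected_iff_exists_isSeparation.1 h
  exact ⟨A, B, _, h, Finset.card_le_four⟩

end Separation

section SeparationOfReduct

variable {V : Type u} {G : SimpleGraph V} {A B : Set V} {T : Finset V}

theorem IsKiteCover.exists_adj_notMem {P : Multiset (Quad V)} (hK : IsKiteCover G P) {v w : V}
    (h : G.Adj v w) (hT : T.card < 6) : ∃ u, G.Adj v u ∧ u ∉ T := by
  by_contra! hsub
  have := (hK.six_le_encard_neighborSet h).trans (Set.encard_le_encard (t := (T : Set V)) hsub)
  rw [Set.encard_coe_eq_coe_finsetCard] at this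
  exact absurd hT (not_lt.2 (by exact_mod_cast this))

theorem CrossedStar.adj_or_of_reduct_adj (M : CrossedStar G) {a b : (({M.x} : Set V)ᶜ : Set V)}
    (h : M.reduct.Adj a b) :
    G.Adj a b ∨ (G.Adj M.x a ∧ G.Adj M.x b ∧ (a.1 = M.x₄ ∨ b.1 = M.x₄)) := by
  have hx₄ : G.Adj M.x M.x₄ := M.neighborSet_eq.ge (by simp)
  refine (M.reduct_adj_iff.1 h).imp And.left ?_
  rintro ⟨⟨v, hv, he⟩, -⟩
  have hxv : G.Adj M.x v := by
    refine M.neighborSet_eq.ge ?_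
    rcases hv with rfl | rfl | rfl <;> simp
  rcases Sym2.eq_iff.1 he with ⟨ha, hb⟩ | ⟨hb, ha⟩ <;> rw [← ha, ← hb]
  · exact ⟨hx₄, hxv, Or.inl rfl⟩
  · exact ⟨hxv, hx₄, Or.inr rfl⟩

namespace IsSeparation

open Classical in
theorem reduct_of_mem_left (h : IsSeparation G A B T) {M : CrossedStar G} (hx : M.x ∈ A)
    (hA : ∃ a ∈ A, a ≠ M.x) :
    IsSeparation M.reduct (Subtype.val ⁻¹' A) (Subtype.val ⁻¹' B)
      (T.subtype (· ∈ ({M.x} : Set V)ᶜ)) where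
  left_nonempty := by
    obtain ⟨a, ha, hax⟩ := hA
    exact ⟨⟨a, hax⟩, ha⟩
  right_nonempty := by
    obtain ⟨b, hb⟩ := h.right_nonempty
    exact ⟨⟨b, fun hbx => h.disjoint.notMem_of_mem_left hx (hbx ▸ hb)⟩, hb⟩
  disjoint := h.disjoint.preimage _
  union_eq := by
    ext v
    simpa using h.mem_or_mem_iff (v := v)
  not_adj a ha b hb hab := by
    rcases M.adj_or_of_reduct_adj hab with hab | ⟨-, hxb, -⟩
    · exact h.not_adj a ha b hb hab
    · exact h.not_adj M.x hx b hb hxb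

open Classical in
theorem reduct_of_mem_cut (h : IsSeparation G A B T) {M : CrossedStar G} (hx : M.x ∈ T)
    (hA : ∃ a ∈ A, a ≠ M.x₄) (hB : ∃ b ∈ B, b ≠ M.x₄) :
    IsSeparation M.reduct (Subtype.val ⁻¹' (A \ {M.x₄})) (Subtype.val ⁻¹' (B \ {M.x₄}))
      ((insert M.x₄ (T.erase M.x)).subtype (· ∈ ({M.x} : Set V)ᶜ)) where
  left_nonempty := by
    obtain ⟨a, ha, hax₄⟩ := hA
    exact ⟨⟨a, fun hax => h.mem_or_mem_iff.1 (Or.inl ha) (hax ▸ hx)⟩, ha, hax₄⟩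
  right_nonempty := by
    obtain ⟨b, hb, hbx₄⟩ := hB
    exact ⟨⟨b, fun hbx => h.mem_or_mem_iff.1 (Or.inr hb) (hbx ▸ hx)⟩, hb, hbx₄⟩
  disjoint := (h.disjoint.mono Set.sdiff_subset Set.sdiff_subset).preimage _
  union_eq := by
    ext v
    have hv : v.1 ≠ M.x := v.2
    have := h.mem_or_mem_iff (v := v)
    simp only [← Set.preimage_union, ← Set.union_sdiff_distrib, Set.mem_preimage, Set.mem_sdiff,
      Set.mem_union, Set.mem_singleton_iff, Set.mem_compl_iff, Finset.mem_coe,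
      Finset.mem_subtype, Finset.mem_insert, Finset.mem_erase]
    tauto
  not_adj a ha b hb hab := by
    rcases M.adj_or_of_reduct_adj hab with hab | ⟨-, -, hax₄ | hbx₄⟩
    · exact h.not_adj a ha.1 b hb.1 hab
    · exact ha.2 hax₄
    · exact hb.2 hbx₄

theorem exists_mem_left_ne (h : IsSeparation G A B T) (hG : HasKiteCover G) (hT : T.card < 6)
    {v w : V} (hvw : G.Adj v w) : ∃ a ∈ A, a ≠ v := by
  obtain ⟨P, hK⟩ := hG
  obtain ⟨a, ha⟩ := h.left_nonempty
  obtain rfl | hav := eq_or_ne a v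
  · obtain ⟨u, hau, hu⟩ := hK.exists_adj_notMem hvw hT
    exact ⟨u, h.mem_left_of_adj ha hau hu, hau.ne'⟩
  · exact ⟨a, ha, hav⟩

end IsSeparation

theorem HasSeparation.reduct {k : ℕ} (h : HasSeparation k G) (hk : k < 6) (hG : HasKiteCover G)
    (M : CrossedStar G) : HasSeparation k M.reduct := by
  classical
  obtain ⟨A, B, T, h, hTk⟩ := h
  have hT : T.card < 6 := hTk.trans_lt hk
  have hx₄ : G.Adj M.x M.x₄ := M.neighborSet_eq.ge (by simp)
  have hcard {S : Finset V} (hS : S.card ≤ k) :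
      (S.subtype (· ∈ ({M.x} : Set V)ᶜ)).card ≤ k := by
    rw [Finset.card_subtype]
    exact (Finset.card_filter_le _ _).trans hS
  by_cases hx : M.x ∈ T
  · refine ⟨_, _, _, h.reduct_of_mem_cut hx (h.exists_mem_left_ne hG hT hx₄.symm)
      (h.symm.exists_mem_left_ne hG hT hx₄.symm), hcard ?_⟩
    calc (insert M.x₄ (T.erase M.x)).card ≤ (T.erase M.x).card + 1 := Finset.card_insert_le _ _
      _ = T.card := Finset.card_erase_add_one hx
      _ ≤ k := hTk
  · rcases h.mem_or_mem_iff.2 hx with hx | hx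
    · exact ⟨_, _, _, h.reduct_of_mem_left hx (h.exists_mem_left_ne hG hT hx₄), hcard hTk⟩
    · exact ⟨_, _, _, h.symm.reduct_of_mem_left hx (h.symm.exists_mem_left_ne hG hT hx₄),
        hcard hTk⟩

theorem SRReducesTo.hasSeparation {k : ℕ} {W : Type u} {H : SimpleGraph W} (h : SRReducesTo G H)
    (hk : k < 6) (hG : HasKiteCover G) (hc : HasSeparation k G) :
    HasKiteCover H ∧ HasSeparation k H := by
  induction h with
  | refl => exact ⟨hG, hc⟩
  | step _ hs ih =>
    obtain ⟨M, hM, ⟨e⟩⟩ := hs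
    exact ⟨(ih.1.reduct hM).of_iso e, (ih.2.reduct hk ih.1 M).of_iso e⟩

end SeparationOfReduct

section ExtendedWheel

variable {k : ℕ}

theorem extendedWheel_adj_pole (p : Fin 2) (i : ZMod (2 * k)) :
    (extendedWheel k).Adj (Sum.inr p) (Sum.inl i) := by
  simp [extendedWheel]

theorem natCast_ne_zero_zmod {m : ℕ} (hm : m ≠ 0) (hmk : m < 2 * k) :
    (m : ZMod (2 * k)) ≠ 0 := fun h =>
  absurd (Nat.le_of_dvd (Nat.pos_of_ne_zero hm) ((ZMod.natCast_eq_zero_iff m _).1 h))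
    (not_le.2 hmk)

theorem extendedWheel_adj_add_one (hk : 3 ≤ k) (i : ZMod (2 * k)) :
    (extendedWheel k).Adj (Sum.inl i) (Sum.inl (i + 1)) := by
  have : (1 : ZMod (2 * k)) ≠ 0 := by
    exact_mod_cast natCast_ne_zero_zmod one_ne_zero (by omega : 1 < 2 * k)
  simp [extendedWheel, this]

theorem extendedWheel_adj_add_two (hk : 3 ≤ k) (i : ZMod (2 * k)) :
    (extendedWheel k).Adj (Sum.inl i) (Sum.inl (i + 2)) := by
  have : (2 : ZMod (2 * k)) ≠ 0 := by
    exact_mod_cast natCast_ne_zero_zmod two_ne_zero (by omega : 2 < 2 * k)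
  simp [extendedWheel, this]

namespace IsSeparation

variable {A B : Set (ZMod (2 * k) ⊕ Fin 2)} {T : Finset (ZMod (2 * k) ⊕ Fin 2)}

theorem pole_notMem_left (h : IsSeparation (extendedWheel k) A B T) (hT : T.card < 2 * k)
    (p : Fin 2) : Sum.inr p ∉ A := by
  classical
  intro hp
  have notMem_right (i : ZMod (2 * k)) : Sum.inl i ∉ B := fun hi =>
    h.not_adj _ hp _ hi (extendedWheel_adj_pole p i)
  obtain ⟨i | q, hb⟩ := h.right_nonempty
  · exact notMem_right i hb
  have notMem_left (i : ZMod (2 * k)) : Sum.inl i ∉ A := fun hi =>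
    h.not_adj _ hi _ hb (extendedWheel_adj_pole q i).symm
  have : NeZero (2 * k) := ⟨by omega⟩
  have hsub : Finset.univ.map .inl ⊆ T := by
    rintro _ hv
    obtain ⟨i, -, rfl⟩ := Finset.mem_map.1 hv
    by_contra hi
    exact (h.mem_or_mem_iff.2 hi).elim (notMem_left i) (notMem_right i)
  have := Finset.card_le_card hsub
  rw [Finset.card_map, Finset.card_univ, ZMod.card] at this
  omega

theorem exists_gap (h : IsSeparation (extendedWheel k) A B T) (hk : 3 ≤ k) {a b : ZMod (2 * k)}
    (ha : Sum.inl a ∈ A) (hb : Sum.inl b ∈ B) :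
    ∃ i : ZMod (2 * k), Sum.inl i ∈ T ∧ Sum.inl (i + 1) ∈ T ∧ Sum.inl (i + 2) ∈ B := by
  have : NeZero (2 * k) := ⟨by omega⟩
  obtain ⟨t, ht, hmin⟩ : ∃ t : ℕ, Sum.inl (a + t) ∈ B ∧ ∀ s < t, Sum.inl (a + s) ∉ B := by
    have hex : ∃ t : ℕ, Sum.inl (a + t) ∈ B := ⟨(b - a).val, by simpa using hb⟩
    classical exact ⟨Nat.find hex, Nat.find_spec hex, fun s => Nat.find_min hex⟩
  have mem_cut {i : ZMod (2 * k)} (hi : Sum.inl i ∉ B)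
      (hadj : (extendedWheel k).Adj (Sum.inl i) (Sum.inl (a + t))) : Sum.inl i ∈ T := by
    by_contra hiT
    exact hi (h.symm.mem_left_of_adj ht hadj.symm hiT)
  match t with
  | 0 => exact absurd (by simpa using ht) (h.disjoint.notMem_of_mem_left ha)
  | 1 =>
    exact absurd (extendedWheel_adj_add_one hk a) (h.not_adj _ ha _ (by simpa using ht))
  | t + 2 =>
    have e₁ : a + ((t + 1 : ℕ) : ZMod (2 * k)) = a + t + 1 := by push_cast; ring
    have e₂ : a + ((t + 2 : ℕ) : ZMod (2 * k)) = a + t + 2 := by push_cast; ring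
    have e₁₂ : a + (t : ZMod (2 * k)) + 2 = a + t + 1 + 1 := by ring
    rw [e₂] at ht mem_cut
    refine ⟨a + t, mem_cut (hmin t (by omega)) (extendedWheel_adj_add_two hk _), ?_, ht⟩
    have hmin' := hmin (t + 1) (by omega)
    rw [e₁] at hmin'
    exact mem_cut hmin' (e₁₂ ▸ extendedWheel_adj_add_one hk _)

theorem five_le_card_of_extendedWheel (h : IsSeparation (extendedWheel k) A B T) (hk : 3 ≤ k) :
    5 ≤ T.card := by
  classical
  by_contra! hT
  have hpA := h.pole_notMem_left (by omega)
  have hpB := h.symm.pole_notMem_left (by omega)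
  have hpT (p : Fin 2) : Sum.inr p ∈ T := by
    by_contra hp
    exact (h.mem_or_mem_iff.2 hp).elim (hpA p) (hpB p)
  obtain ⟨a | p, ha⟩ := h.left_nonempty
  swap; · exact hpA p ha
  obtain ⟨b | p, hb⟩ := h.right_nonempty
  swap; · exact hpB p hb
  obtain ⟨i, hi, hi₁, hi₂⟩ := h.exists_gap hk ha hb
  obtain ⟨j, hj, hj₁, hj₂⟩ := h.symm.exists_gap hk hb ha
  have hij : i ≠ j := by
    rintro rfl
    exact h.disjoint.notMem_of_mem_left hj₂ hi₂
  have eq_or_eq {u : ZMod (2 * k)} (hu : Sum.inl u ∈ T) : u = i ∨ u = i + 1 := by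
    by_contra! hne
    have hsub : {Sum.inr 0, Sum.inr 1, Sum.inl i, Sum.inl (i + 1), Sum.inl u} ⊆ T := by
      simp only [Finset.insert_subset_iff, Finset.singleton_subset_iff]
      exact ⟨hpT 0, hpT 1, hi, hi₁, hu⟩
    have := Finset.card_le_card hsub
    rw [Finset.card_insert_of_notMem (by simp), Finset.card_insert_of_notMem (by simp),
      Finset.card_insert_of_notMem, Finset.card_insert_of_notMem, Finset.card_singleton] at this
    · omega
    · simpa using hne.2.symm
    · simpa [hne.1.symm] using (extendedWheel_adj_add_one hk i).ne
  obtain rfl : j = i + 1 := (eq_or_eq hj).resolve_left hij.symm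
  have hi₁₁ : i + 1 + 1 = i + 2 := by ring
  rcases eq_or_eq hj₁ with hne | hne
  · exact (extendedWheel_adj_add_two hk i).ne (by rw [← hi₁₁, hne])
  · exact (extendedWheel_adj_add_one hk (i + 1)).ne (by rw [hne])

end IsSeparation

theorem not_hasSeparation_extendedWheel (hk : 3 ≤ k) : ¬ HasSeparation 4 (extendedWheel k) := by
  rintro ⟨A, B, T, h, hT⟩
  have := h.five_le_card_of_extendedWheel hk
  omega

end ExtendedWheel

/-! ### Rotation systems and their faces -/

section RotationSystem

variable {X : Type u} {Γ : SimpleGraph X} {σ : Equiv.Perm Γ.Dart}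

/-- The permutation of the darts whose cycles are the facial walks of a rotation system. -/
def faceNext (σ : Equiv.Perm Γ.Dart) : Equiv.Perm Γ.Dart := σ * reversePerm Γ

/-- The faces of a rotation system. -/
abbrev Face (σ : Equiv.Perm Γ.Dart) : Type u :=
  Quotient (Equiv.Perm.SameCycle.setoid (faceNext σ))

/-- The face on which a dart lies. -/
def faceOf (σ : Equiv.Perm Γ.Dart) (d : Γ.Dart) : Face σ := Quotient.mk _ d

/-- The faces of length two. -/
def digons (σ : Equiv.Perm Γ.Dart) : Set (Face σ) :=
  {q | ∃ d, faceOf σ d = q ∧ faceNext σ (faceNext σ d) = d}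

theorem faceNext_symm (d : Γ.Dart) : faceNext σ d.symm = σ d := by
  rw [faceNext, Equiv.Perm.mul_apply]
  exact congrArg σ d.symm_symm

theorem faceOf_faceNext (d : Γ.Dart) : faceOf σ (faceNext σ d) = faceOf σ d :=
  Quotient.sound (Equiv.Perm.sameCycle_apply_left.2 (Equiv.Perm.SameCycle.refl _ d))

theorem eq_of_fst_eq_of_snd_eq {d e : Γ.Dart} (h₁ : d.fst = e.fst) (h₂ : d.snd = e.snd) :
    d = e :=
  SimpleGraph.Dart.ext _ _ (Prod.ext h₁ h₂)

theorem eq_of_reachable_of_isIsolated {v w : X} (hv : Γ.IsIsolated v)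
    (h : Γ.Reachable v w) : v = w := by
  obtain ⟨_ | ⟨hadj, _⟩⟩ := h
  · rfl
  · exact absurd hadj (hv _)

theorem injective_connectedComponentMk_isolated :
    Function.Injective fun v : {v | Γ.IsIsolated v} => Γ.connectedComponentMk v.1 :=
  fun v _ h => Subtype.ext
    (eq_of_reachable_of_isIsolated v.2 (SimpleGraph.ConnectedComponent.eq.1 h))

theorem connectedComponentMk_isolated_ne (d : Γ.Dart) {v : X} (hv : Γ.IsIsolated v) :
    Γ.connectedComponentMk v ≠ Γ.connectedComponentMk d.fst := by
  intro h
  obtain rfl := eq_of_reachable_of_isIsolated hv (SimpleGraph.ConnectedComponent.eq.1 h)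
  exact hv _ d.adj

theorem card_isolated_lt [Finite X] (d : Γ.Dart) :
    {v | Γ.IsIsolated v}.ncard < Nat.card Γ.ConnectedComponent := by
  classical
  have := Fintype.ofFinite X
  have := Fintype.ofFinite Γ.ConnectedComponent
  rw [← Nat.card_coe_set_eq, Nat.card_eq_fintype_card, Nat.card_eq_fintype_card]
  refine Fintype.card_lt_of_injective_of_notMem _ injective_connectedComponentMk_isolated
    (b := Γ.connectedComponentMk d.fst) ?_
  rintro ⟨v, hv⟩
  exact connectedComponentMk_isolated_ne d v.2 hv

namespace IsRotationSystem

theorem fst_apply (hσ : IsRotationSystem Γ σ) (d : Γ.Dart) : (σ d).fst = d.fst :=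
  (hσ _ _).1 (Equiv.Perm.sameCycle_apply_left.2 (Equiv.Perm.SameCycle.refl σ d))

theorem fst_faceNext (hσ : IsRotationSystem Γ σ) (d : Γ.Dart) : (faceNext σ d).fst = d.snd :=
  hσ.fst_apply d.symm

theorem faceNext_ne (hσ : IsRotationSystem Γ σ) (d : Γ.Dart) : faceNext σ d ≠ d := fun h =>
  d.fst_ne_snd (by rw [← hσ.fst_faceNext d, h])

theorem faceNext_eq_symm (hσ : IsRotationSystem Γ σ) {d : Γ.Dart}
    (h : faceNext σ (faceNext σ d) = d) : faceNext σ d = d.symm :=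
  eq_of_fst_eq_of_snd_eq (hσ.fst_faceNext d) ((hσ.fst_faceNext _).symm.trans (by rw [h]; rfl))

theorem eq_of_apply_eq (hσ : IsRotationSystem Γ σ) {d e : Γ.Dart} (h : σ d = d)
    (he : e.fst = d.fst) : e = d := by
  obtain ⟨i, hi⟩ := (hσ d e).2 he.symm
  rw [Equiv.Perm.zpow_apply_eq_self_of_apply_eq_self h] at hi
  exact hi.symm

theorem eq_or_eq_symm_of_digon (hσ : IsRotationSystem Γ σ) {d e : Γ.Dart}
    (h : faceNext σ (faceNext σ d) = d) (he : e.fst = d.fst ∨ e.fst = d.snd) :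
    e = d ∨ e = d.symm := by
  have hsymm : faceNext σ d = d.symm := hσ.faceNext_eq_symm h
  refine he.imp (hσ.eq_of_apply_eq ?_) (hσ.eq_of_apply_eq hsymm)
  rwa [hsymm, faceNext_symm] at h

theorem eq_or_eq_of_reachable_of_digon (hσ : IsRotationSystem Γ σ) {d : Γ.Dart}
    (h : faceNext σ (faceNext σ d) = d) {x : X} (hx : Γ.Reachable d.fst x) :
    x = d.fst ∨ x = d.snd := by
  rw [SimpleGraph.reachable_iff_reflTransGen] at hx
  induction hx with
  | refl => exact Or.inl rfl
  | tail _ hadj ih =>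
    rcases hσ.eq_or_eq_symm_of_digon h (e := ⟨(_, _), hadj⟩) ih with heq | heq
    · exact Or.inr (congrArg (·.snd) heq)
    · exact Or.inl (congrArg (·.snd) heq)

theorem faceOf_eq_of_reachable_of_digon (hσ : IsRotationSystem Γ σ) {d e : Γ.Dart}
    (h : faceNext σ (faceNext σ d) = d) (he : Γ.Reachable d.fst e.fst) :
    faceOf σ d = faceOf σ e := by
  rcases hσ.eq_or_eq_symm_of_digon h (hσ.eq_or_eq_of_reachable_of_digon h he) with rfl | rfl
  · rfl
  · rw [← hσ.faceNext_eq_symm h, faceOf_faceNext]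

theorem card_isolated_add_card_digons_le (hσ : IsRotationSystem Γ σ) [Finite X] :
    {v | Γ.IsIsolated v}.ncard + (digons σ).ncard ≤ Nat.card Γ.ConnectedComponent := by
  classical
  choose dart hface hdigon using fun q : digons σ => q.2
  have hinj : Function.Injective fun q => Γ.connectedComponentMk (dart q).fst := fun q r h =>
    Subtype.ext <| by
      rw [← hface, ← hface]
      exact hσ.faceOf_eq_of_reachable_of_digon (hdigon q) (SimpleGraph.ConnectedComponent.eq.1 h)
  have : Finite (digons σ) := Finite.of_injective _ hinj
  rw [← Nat.card_coe_set_eq, ← Nat.card_coe_set_eq, ← Nat.card_sum]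
  exact Nat.card_le_card_of_injective _ (injective_connectedComponentMk_isolated.sumElim hinj
    fun v q => connectedComponentMk_isolated_ne (dart q) v.2)

theorem card_le_two_of_digon (hσ : IsRotationSystem Γ σ) {d : Γ.Dart}
    (h : faceNext σ (faceNext σ d) = d) (hcard : Nat.card Γ.ConnectedComponent = 1) :
    Nat.card X ≤ 2 := by
  have := (Nat.card_eq_one_iff_unique.1 hcard).1
  have hpair : Set.univ ⊆ ({d.fst, d.snd} : Set X) := fun x _ =>
    hσ.eq_or_eq_of_reachable_of_digon h
      (SimpleGraph.ConnectedComponent.eq.1 (Subsingleton.elim _ _))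
  rw [← Set.ncard_univ]
  exact (Set.ncard_le_ncard hpair (Set.toFinite _)).trans
    ((Set.ncard_insert_le _ _).trans_eq (by rw [Set.ncard_singleton]))

theorem card_triple [DecidableEq X] (hσ : IsRotationSystem Γ σ) {d : Γ.Dart}
    (h : faceNext σ (faceNext σ d) ≠ d) :
    ({d, faceNext σ d, faceNext σ (faceNext σ d)} : Finset Γ.Dart).card = 3 :=
  Finset.card_eq_three.2 ⟨_, _, _, (hσ.faceNext_ne d).symm, h.symm, (hσ.faceNext_ne _).symm, rfl⟩

end IsRotationSystem

section FaceDarts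

variable [Fintype Γ.Dart]

open Classical in
/-- The darts on the facial walk of a face. -/
noncomputable def faceDarts (q : Face σ) : Finset Γ.Dart :=
  Finset.univ.filter fun d => faceOf σ d = q

theorem mem_faceDarts {q : Face σ} {d : Γ.Dart} : d ∈ faceDarts q ↔ faceOf σ d = q := by
  simp [faceDarts]

theorem triple_subset_faceDarts [DecidableEq X] (d : Γ.Dart) :
    {d, faceNext σ d, faceNext σ (faceNext σ d)} ⊆ faceDarts (faceOf σ d) := by
  simp [Finset.insert_subset_iff, mem_faceDarts, faceOf_faceNext]

open Classical in
theorem IsRotationSystem.three_le_card_faceDarts_add (hσ : IsRotationSystem Γ σ) (q : Face σ) :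
    3 ≤ (faceDarts q).card + if q ∈ digons σ then 1 else 0 := by
  obtain ⟨d, rfl⟩ : ∃ d, faceOf σ d = q := Quotient.exists_rep q
  have hsub := triple_subset_faceDarts (σ := σ) d
  split_ifs with hq
  · have : ({d, faceNext σ d} : Finset Γ.Dart) ⊆ faceDarts (faceOf σ d) :=
      Finset.Subset.trans (by grind) hsub
    have := Finset.card_le_card this
    rw [Finset.card_pair (hσ.faceNext_ne d).symm] at this
    omega
  · rw [← hσ.card_triple fun h => hq ⟨d, rfl, h⟩]
    exact Finset.card_le_card hsub

theorem IsRotationSystem.faceNext_eq_of_card_faceDarts (hσ : IsRotationSystem Γ σ) {d : Γ.Dart}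
    (hd : (faceDarts (faceOf σ d)).card = 3) (hdigons : digons σ = ∅) :
    faceNext σ (faceNext σ (faceNext σ d)) = d := by
  classical
  have hno (e : Γ.Dart) : faceNext σ (faceNext σ e) ≠ e := fun h =>
    hdigons.subset (show faceOf σ e ∈ digons σ from ⟨e, rfl, h⟩)
  have heq := Finset.eq_of_subset_of_card_le (triple_subset_faceDarts d)
    (by rw [hσ.card_triple (hno d), hd])
  have hmem : faceNext σ (faceNext σ (faceNext σ d)) ∈ faceDarts (faceOf σ d) := by
    rw [mem_faceDarts, faceOf_faceNext, faceOf_faceNext, faceOf_faceNext]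
  rw [← heq, Finset.mem_insert, Finset.mem_insert, Finset.mem_singleton] at hmem
  exact hmem.resolve_right (not_or_intro (hno _) (hσ.faceNext_ne _))

theorem sum_card_faceDarts [Finite X] [Fintype (Face σ)] :
    ∑ q : Face σ, (faceDarts q).card = 2 * Γ.edgeSet.ncard := by
  classical
  have := Fintype.ofFinite X
  have hcard : (Finset.univ : Finset Γ.Dart).card = 2 * Γ.edgeSet.ncard := by
    rw [Finset.card_univ, ← SimpleGraph.coe_edgeFinset, Set.ncard_coe_finset]
    convert Γ.dart_card_eq_twice_card_edges
  rw [← hcard, Finset.card_eq_sum_card_fiberwise (t := Finset.univ) (f := faceOf σ) (by simp)]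
  rfl

end FaceDarts

section FaceCount

theorem faceCount_eq_card [Fintype (Face σ)] : faceCount Γ σ = Fintype.card (Face σ) :=
  Nat.card_eq_fintype_card (α := Face σ)

variable [Finite X]

theorem IsRotationSystem.three_mul_faceCount_le (hσ : IsRotationSystem Γ σ) :
    3 * faceCount Γ σ ≤ 2 * Γ.edgeSet.ncard + (digons σ).ncard := by
  classical
  have := Fintype.ofFinite X
  have : Finite (Face σ) := Quotient.finite _
  have := Fintype.ofFinite (Face σ)
  have hdigons : (digons σ).ncard = ∑ q : Face σ, if q ∈ digons σ then 1 else 0 := by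
    rw [Finset.sum_boole, Nat.cast_id, ← Set.ncard_coe_finset, Finset.coe_filter_univ]
    rfl
  rw [faceCount_eq_card, Fintype.card, mul_comm, ← smul_eq_mul, ← Finset.sum_const, hdigons,
    ← sum_card_faceDarts (σ := σ), ← Finset.sum_add_distrib]
  exact Finset.sum_le_sum fun q _ => hσ.three_le_card_faceDarts_add q

theorem IsRotationSystem.triangle_of_three_mul_faceCount_eq (hσ : IsRotationSystem Γ σ)
    (hdigons : digons σ = ∅) (hcard : 3 * faceCount Γ σ = 2 * Γ.edgeSet.ncard) (d : Γ.Dart) :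
    faceNext σ (faceNext σ (faceNext σ d)) = d := by
  classical
  have := Fintype.ofFinite X
  have : Finite (Face σ) := Quotient.finite _
  have := Fintype.ofFinite (Face σ)
  have hle (q : Face σ) : 3 ≤ (faceDarts q).card := by
    simpa [hdigons] using hσ.three_le_card_faceDarts_add q
  have hsum : ∑ q : Face σ, 3 = ∑ q : Face σ, (faceDarts q).card := by
    rw [sum_card_faceDarts, ← hcard, faceCount_eq_card, Finset.sum_const, Finset.card_univ,
      smul_eq_mul, mul_comm]
  exact hσ.faceNext_eq_of_card_faceDarts
    ((Finset.sum_eq_sum_iff_of_le fun q _ => hle q).1 hsum _ (Finset.mem_univ _)).symm hdigons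

end FaceCount

end RotationSystem

/-! ### Crossing patterns -/

/-- The crossing of the kite on a quadrilateral: the unordered pair of its diagonals. -/
def diagonalPair {V : Type u} : Quad V → Sym2 (Sym2 V)
  | (a, b, c, d) => s(s(a, c), s(b, d))

theorem mem_diagonalPair {V : Type u} {q : Quad V} {e : Sym2 V} :
    e ∈ diagonalPair q ↔ e ∈ diagonals q := by
  obtain ⟨a, b, c, d⟩ := q
  rw [mem_diagonals, diagonalPair, Sym2.mem_iff]

namespace CrossingPattern

variable {V : Type u} {G : SimpleGraph V} (C : CrossingPattern G)

theorem eq_of_mem {p : Sym2 (Sym2 V)} (hp : p ∈ C.pairs) {e f : Sym2 V} {w : V} (he : e ∈ p)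
    (hf : f ∈ p) (hwe : w ∈ e) (hwf : w ∈ f) : e = f := by
  by_contra hne
  obtain rfl := (Sym2.mem_and_mem_iff hne).1 ⟨he, hf⟩
  exact C.disjoint e f hp w hwe hwf

theorem exists_diagonalPair_eq (p : C.pairs) : ∃ q, diagonalPair q = p.1 := by
  obtain ⟨⟨⟨a, c⟩, ⟨b, d⟩⟩, hp⟩ := p
  exact ⟨(a, b, c, d), rfl⟩

theorem nodup_of_mem_pairs {a b c d : V} (hp : s(s(a, c), s(b, d)) ∈ C.pairs) :
    [a, b, c, d].Nodup := by
  have hac : a ≠ c := (C.isEdge _ hp s(a, c) (Sym2.mem_mk_left _ _)).ne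
  have hbd : b ≠ d := (C.isEdge _ hp s(b, d) (Sym2.mem_mk_right _ _)).ne
  have ha := C.disjoint _ _ hp a (Sym2.mem_mk_left _ _)
  have hc := C.disjoint _ _ hp c (Sym2.mem_mk_right _ _)
  simp only [Sym2.mem_iff, not_or] at ha hc
  simp only [List.nodup_cons, List.mem_cons, List.not_mem_nil, or_false, not_or,
    List.nodup_nil, not_false_eq_true, and_true]
  grind

theorem nodup_diagonals {q : Quad V} (hq : diagonalPair q ∈ C.pairs) : (diagonals q).Nodup := by
  obtain ⟨a, b, c, d⟩ := q
  have hne : s(a, c) ≠ s(b, d) := fun h =>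
    C.disjoint _ _ hq a (Sym2.mem_mk_left _ _) (h ▸ Sym2.mem_mk_left _ _)
  simpa [diagonals] using hne

theorem nodup_sides {q : Quad V} (hq : diagonalPair q ∈ C.pairs) : (sides q).Nodup := by
  obtain ⟨a, b, c, d⟩ := q
  have h := C.nodup_of_mem_pairs hq
  simp only [List.nodup_cons, List.mem_cons, List.not_mem_nil, or_false, not_or,
    List.nodup_nil, not_false_eq_true, and_true] at h
  simp only [sides, Multiset.singleton_add, Multiset.cons_add, Multiset.nodup_cons,
    Multiset.mem_cons, Multiset.mem_singleton, Multiset.nodup_singleton, Sym2.eq_iff]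
  grind

theorem adj_inr_inl_iff {p : C.pairs} {v a b c d : V} (h : p.1 = s(s(a, c), s(b, d))) :
    C.planarization.Adj (Sum.inr p) (Sum.inl v) ↔ v = a ∨ v = b ∨ v = c ∨ v = d := by
  change (∃ e ∈ p.1, v ∈ e) ↔ _
  simp only [h, Sym2.mem_iff, exists_eq_or_imp, exists_eq_left]
  tauto

theorem ncard_neighborSet_inr (p : C.pairs) :
    (C.planarization.neighborSet (Sum.inr p)).ncard = 4 := by
  classical
  obtain ⟨⟨a, b, c, d⟩, hp⟩ := C.exists_diagonalPair_eq p
  have hset : C.planarization.neighborSet (Sum.inr p) = Sum.inl '' {v | v ∈ [a, b, c, d]} := by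
    ext (v | r)
    · rw [SimpleGraph.mem_neighborSet, C.adj_inr_inl_iff hp.symm]
      simp
    · simp [planarization]
  rw [hset, Set.ncard_image_of_injective _ Sum.inl_injective, ← List.coe_toFinset,
    Set.ncard_coe_finset, List.toFinset_card_of_nodup]
  · rfl
  · exact C.nodup_of_mem_pairs (show diagonalPair (a, b, c, d) ∈ C.pairs from hp ▸ p.2)

open Classical in
/-- The other end of the first segment of the edge from `a` to `b`, seen from `a`. -/
noncomputable def segmentEnd (a b : V) : V ⊕ C.pairs :=
  if h : ∃ p ∈ C.pairs, s(a, b) ∈ p then Sum.inr ⟨h.choose, h.choose_spec.1⟩ else Sum.inl b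

variable {C} in
theorem segmentEnd_of_mem {p : C.pairs} {a b : V} (h : s(a, b) ∈ p.1) :
    C.segmentEnd a b = Sum.inr p := by
  have hex : ∃ p ∈ C.pairs, s(a, b) ∈ p := ⟨p.1, p.2, h⟩
  rw [segmentEnd, dif_pos hex]
  exact congrArg Sum.inr
    (Subtype.ext (C.crossedOnce _ hex.choose_spec.1 _ p.2 _ hex.choose_spec.2 h))

variable {C} in
theorem segmentEnd_of_forall_notMem {a b : V} (h : ∀ p ∈ C.pairs, s(a, b) ∉ p) :
    C.segmentEnd a b = Sum.inl b :=
  dif_neg fun ⟨p, hp, hmem⟩ => h p hp hmem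

theorem image_segmentEnd (a : V) :
    C.segmentEnd a '' G.neighborSet a = C.planarization.neighborSet (Sum.inl a) := by
  ext x
  constructor
  · rintro ⟨b, hb, rfl⟩
    by_cases h : ∃ p ∈ C.pairs, s(a, b) ∈ p
    · obtain ⟨p, hp, hmem⟩ := h
      rw [segmentEnd_of_mem (p := ⟨p, hp⟩) hmem]
      exact ⟨s(a, b), hmem, Sym2.mem_mk_left _ _⟩
    · push Not at h
      rw [segmentEnd_of_forall_notMem h]
      exact ⟨hb, h⟩
  · intro hx
    rcases x with b | p
    · exact ⟨b, hx.1, segmentEnd_of_forall_notMem hx.2⟩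
    · obtain ⟨e, he, hae⟩ := hx
      obtain ⟨b, rfl⟩ := Sym2.mem_iff_exists.1 hae
      exact ⟨b, C.isEdge _ p.2 _ he, segmentEnd_of_mem he⟩

theorem segmentEnd_injective (a : V) : Function.Injective (C.segmentEnd a) := by
  intro b c hbc
  by_cases hb : ∃ p ∈ C.pairs, s(a, b) ∈ p <;> by_cases hc : ∃ p ∈ C.pairs, s(a, c) ∈ p
  · obtain ⟨p, hp, hbp⟩ := hb
    obtain ⟨r, hr, hcr⟩ := hc
    rw [segmentEnd_of_mem (p := ⟨p, hp⟩) hbp, segmentEnd_of_mem (p := ⟨r, hr⟩) hcr] at hbc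
    obtain rfl : p = r := congrArg Subtype.val (Sum.inr.inj hbc)
    exact Sym2.congr_right.1
      (C.eq_of_mem hp hbp hcr (Sym2.mem_mk_left _ _) (Sym2.mem_mk_left _ _))
  · simp [segmentEnd, dif_pos hb, dif_neg hc] at hbc
  · simp [segmentEnd, dif_neg hb, dif_pos hc] at hbc
  · simpa [segmentEnd, dif_neg hb, dif_neg hc] using hbc

theorem ncard_neighborSet_inl (a : V) :
    (C.planarization.neighborSet (Sum.inl a)).ncard = (G.neighborSet a).ncard := by
  rw [← C.image_segmentEnd, Set.ncard_image_of_injective _ (C.segmentEnd_injective a)]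

section Fintype

variable [Fintype V] [Fintype C.pairs]

open Classical in
theorem degree_planarization_inl (a : V) : C.planarization.degree (Sum.inl a) = G.degree a := by
  rw [← SimpleGraph.card_neighborFinset_eq_degree, ← SimpleGraph.card_neighborFinset_eq_degree,
    ← Set.ncard_coe_finset, ← Set.ncard_coe_finset, SimpleGraph.coe_neighborFinset,
    SimpleGraph.coe_neighborFinset, C.ncard_neighborSet_inl]

open Classical in
theorem degree_planarization_inr (p : C.pairs) : C.planarization.degree (Sum.inr p) = 4 := by
  rw [← SimpleGraph.card_neighborFinset_eq_degree, ← Set.ncard_coe_finset,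
    SimpleGraph.coe_neighborFinset, C.ncard_neighborSet_inr]

open Classical in
theorem card_filter_fst_isLeft :
    (Finset.univ.filter fun d : C.planarization.Dart => d.fst.isLeft).card =
      2 * G.edgeSet.ncard := by
  have hfiber (v : V ⊕ C.pairs) : (Finset.univ.filter fun d : C.planarization.Dart =>
      d.fst.isLeft ∧ d.fst = v).card = if v.isLeft then C.planarization.degree v else 0 := by
    rw [← SimpleGraph.dart_fst_fiber_card_eq_degree]
    split_ifs with h
    · exact congrArg Finset.card (Finset.filter_congr (by grind))
    · exact Finset.card_eq_zero.2 (Finset.filter_eq_empty_iff.2 (by grind))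
  rw [Finset.card_eq_sum_card_fiberwise (t := Finset.univ) (f := fun d => d.fst) (by simp)]
  simp only [Finset.filter_filter, hfiber, Fintype.sum_sum_type, Sum.isLeft_inl, if_true,
    Sum.isLeft_inr, Bool.false_eq_true, if_false, Finset.sum_const_zero, add_zero,
    degree_planarization_inl]
  rw [G.sum_degrees_eq_twice_card_edges, ← SimpleGraph.coe_edgeFinset, Set.ncard_coe_finset]

end Fintype

theorem ncard_edgeSet_planarization [Finite V] :
    C.planarization.edgeSet.ncard = G.edgeSet.ncard + 2 * Nat.card C.pairs := by
  classical
  have := Fintype.ofFinite V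
  have := Fintype.ofFinite C.pairs
  have hsum := C.planarization.sum_degrees_eq_twice_card_edges
  rw [Fintype.sum_sum_type] at hsum
  simp only [degree_planarization_inl, degree_planarization_inr, Finset.sum_const,
    Finset.card_univ, smul_eq_mul, G.sum_degrees_eq_twice_card_edges] at hsum
  rw [← SimpleGraph.coe_edgeFinset, ← SimpleGraph.coe_edgeFinset, Set.ncard_coe_finset,
    Set.ncard_coe_finset, Nat.card_eq_fintype_card]
  omega

open Classical in
theorem count_bind_diagonals [Fintype C.pairs] {q : C.pairs → Quad V}
    (hq : ∀ p, diagonalPair (q p) = p.1) (e : Sym2 V) :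
    ((Finset.univ.val.map q).bind diagonals).count e =
      if ∃ p ∈ C.pairs, e ∈ p then 1 else 0 := by
  have hmem (p : C.pairs) : e ∈ diagonals (q p) ↔ e ∈ p.1 := by rw [← mem_diagonalPair, hq]
  have hcount (p : C.pairs) : (diagonals (q p)).count e = if e ∈ p.1 then 1 else 0 := by
    rw [Multiset.count_eq_of_nodup (C.nodup_diagonals ((hq p).symm ▸ p.2))]
    simp only [hmem]
  have hsum : ((Finset.univ.val.map q).bind diagonals).count e =
      ∑ p : C.pairs, if e ∈ p.1 then 1 else 0 := by
    rw [Multiset.bind_map, Multiset.count_bind]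
    exact Finset.sum_congr rfl fun p _ => hcount p
  rw [hsum, Finset.sum_boole, Nat.cast_id]
  split_ifs with h
  · obtain ⟨p, hp, he⟩ := h
    refine Finset.card_eq_one.2 ⟨⟨p, hp⟩, ?_⟩
    ext r
    simp only [Finset.mem_filter, Finset.mem_univ, true_and, Finset.mem_singleton]
    exact ⟨fun hr => Subtype.ext (C.crossedOnce _ r.2 _ hp e hr he), fun hr => hr ▸ he⟩
  · exact Finset.card_eq_zero.2
      (Finset.filter_eq_empty_iff.2 fun p _ he => h ⟨p.1, p.2, he⟩)

end CrossingPattern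

/-! ### Kites of optimal 1-planar drawings -/

section KiteTriangulation

variable {V : Type u} {G : SimpleGraph V} {C : CrossingPattern G}
  {σ : Equiv.Perm C.planarization.Dart}

/-- The two halves of a crossed edge are opposite to each other at the crossing. -/
def IsOppositeAtCrossings (σ : Equiv.Perm C.planarization.Dart) : Prop :=
  ∀ (d : C.planarization.Dart) (p : C.pairs) (a b : V),
    d.fst = Sum.inr p → d.snd = Sum.inl a → s(a, b) ∈ p.1 → (σ (σ d)).snd = Sum.inl b

/-- All faces of the planarization are triangles with a crossing as a vertex. -/
structure IsKiteTriangulation (σ : Equiv.Perm C.planarization.Dart) : Prop where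
  isRotationSystem : IsRotationSystem C.planarization σ
  isOpposite : IsOppositeAtCrossings σ
  triangle : ∀ d, faceNext σ (faceNext σ (faceNext σ d)) = d
  exists_crossing : ∀ (d : C.planarization.Dart) (a b : V), d.fst = Sum.inl a →
    d.snd = Sum.inl b → ∃ p, (faceNext σ d).snd = Sum.inr p

theorem exists_snd_eq_inl {d : C.planarization.Dart} {p : C.pairs} (hd : d.fst = Sum.inr p) :
    ∃ a, d.snd = Sum.inl a := by
  have hadj := d.adj
  rw [hd] at hadj
  rcases h : d.snd with a | r
  · exact ⟨a, rfl⟩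
  · rw [h] at hadj
    exact hadj.elim

theorem exists_mem_of_fst_of_snd {d : C.planarization.Dart} {p : C.pairs} {a : V}
    (hd : d.fst = Sum.inr p) (ha : d.snd = Sum.inl a) : ∃ b, s(a, b) ∈ p.1 ∧ a ≠ b := by
  obtain ⟨e, he, hae⟩ : C.planarization.Adj (Sum.inr p) (Sum.inl a) := hd ▸ ha ▸ d.adj
  obtain ⟨b, rfl⟩ := Sym2.mem_iff_exists.1 hae
  exact ⟨b, he, (C.isEdge _ p.2 _ he : G.Adj a b).ne⟩

theorem IsOppositeAtCrossings.apply_apply_ne (ho : IsOppositeAtCrossings σ)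
    {d : C.planarization.Dart} {p : C.pairs} (hd : d.fst = Sum.inr p) : σ (σ d) ≠ d := by
  intro h
  obtain ⟨a, ha⟩ := exists_snd_eq_inl hd
  obtain ⟨b, hmem, hab⟩ := exists_mem_of_fst_of_snd hd ha
  have hb := ho d p a b hd ha hmem
  rw [h, ha] at hb
  exact hab (Sum.inl.inj hb)

theorem IsOppositeAtCrossings.apply_ne (ho : IsOppositeAtCrossings σ)
    {d : C.planarization.Dart} {p : C.pairs} (hd : d.fst = Sum.inr p) : σ d ≠ d := fun h =>
  ho.apply_apply_ne hd (by rw [h, h])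

section FaceCorners

variable [Fintype C.planarization.Dart]

/-- The corners of a face at vertices of the graph itself, given by the darts leaving them. -/
noncomputable def originalCorners (q : Face σ) : Finset C.planarization.Dart :=
  (faceDarts q).filter fun d => d.fst.isLeft

theorem mem_originalCorners {q : Face σ} {d : C.planarization.Dart} :
    d ∈ originalCorners q ↔ faceOf σ d = q ∧ d.fst.isLeft := by
  rw [originalCorners, Finset.mem_filter, mem_faceDarts]

/-- No two crossings are adjacent in the planarization. -/
theorem two_le_card_originalCorners (hr : IsRotationSystem C.planarization σ)
    (ho : IsOppositeAtCrossings σ) (q : Face σ) : 2 ≤ (originalCorners q).card := by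
  classical
  have next_isLeft {d : C.planarization.Dart} {p : C.pairs} (hd : d.fst = Sum.inr p) :
      (faceNext σ d).fst.isLeft := by
    obtain ⟨a, ha⟩ := exists_snd_eq_inl hd
    rw [hr.fst_faceNext, ha, Sum.isLeft_inl]
  obtain ⟨d, rfl, hd⟩ : ∃ d, faceOf σ d = q ∧ d.fst.isLeft := by
    obtain ⟨d, rfl⟩ : ∃ d, faceOf σ d = q := Quotient.exists_rep q
    rcases h : d.fst with a | p
    · exact ⟨d, rfl, by rw [h, Sum.isLeft_inl]⟩
    · exact ⟨faceNext σ d, faceOf_faceNext d, next_isLeft h⟩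
  obtain ⟨e, hne, he⟩ : ∃ e, d ≠ e ∧ e ∈ originalCorners (faceOf σ d) := by
    rcases h : d.snd with a | p
    · exact ⟨faceNext σ d, (hr.faceNext_ne d).symm,
        mem_originalCorners.2 ⟨faceOf_faceNext d, by rw [hr.fst_faceNext, h, Sum.isLeft_inl]⟩⟩
    · refine ⟨faceNext σ (faceNext σ d), fun h' => ?_, mem_originalCorners.2
        ⟨by rw [faceOf_faceNext, faceOf_faceNext], next_isLeft ((hr.fst_faceNext d).trans h)⟩⟩
      exact ho.apply_ne (d := d.symm) h (hr.faceNext_eq_symm h'.symm)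
  rw [← Finset.card_pair hne]
  exact Finset.card_le_card
    (Finset.insert_subset (mem_originalCorners.2 ⟨rfl, hd⟩) (Finset.singleton_subset_iff.2 he))

theorem sum_card_originalCorners [Finite V] [Fintype (Face σ)] :
    ∑ q : Face σ, (originalCorners q).card = 2 * G.edgeSet.ncard := by
  classical
  have := Fintype.ofFinite V
  have := Fintype.ofFinite C.pairs
  have hcard : (Finset.univ.filter fun d : C.planarization.Dart => d.fst.isLeft).card =
      2 * G.edgeSet.ncard := by
    convert C.card_filter_fst_isLeft
  rw [← hcard, Finset.card_eq_sum_card_fiberwise (t := Finset.univ) (f := faceOf σ) (by simp)]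
  refine Finset.sum_congr rfl fun q _ => congrArg Finset.card ?_
  ext d
  simp [mem_originalCorners, and_comm]

end FaceCorners

section OptimalDrawing

variable [Finite V]

theorem faceCount_le_ncard_edgeSet (hr : IsRotationSystem C.planarization σ)
    (ho : IsOppositeAtCrossings σ) :
    faceCount C.planarization σ ≤ G.edgeSet.ncard := by
  classical
  have := Fintype.ofFinite V
  have := Fintype.ofFinite C.pairs
  have : Finite (Face σ) := Quotient.finite _
  have := Fintype.ofFinite (Face σ)
  have hsum : ∑ q : Face σ, 2 ≤ ∑ q : Face σ, (originalCorners q).card :=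
    Finset.sum_le_sum fun q _ => two_le_card_originalCorners hr ho q
  rw [sum_card_originalCorners, Finset.sum_const, Finset.card_univ, smul_eq_mul] at hsum
  rw [faceCount_eq_card]
  omega

theorem exists_crossing_of_faceCount_eq (hr : IsRotationSystem C.planarization σ)
    (ho : IsOppositeAtCrossings σ) (hcard : faceCount C.planarization σ = G.edgeSet.ncard)
    (hdigons : digons σ = ∅) {d : C.planarization.Dart} {a b : V} (ha : d.fst = Sum.inl a)
    (hb : d.snd = Sum.inl b) : ∃ p, (faceNext σ d).snd = Sum.inr p := by
  classical
  have := Fintype.ofFinite V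
  have := Fintype.ofFinite C.pairs
  have : Finite (Face σ) := Quotient.finite _
  have := Fintype.ofFinite (Face σ)
  have hsum : ∑ q : Face σ, 2 = ∑ q : Face σ, (originalCorners q).card := by
    rw [sum_card_originalCorners, ← hcard, faceCount_eq_card, Finset.sum_const, Finset.card_univ,
      smul_eq_mul, mul_comm]
  have htwo : 2 = (originalCorners (faceOf σ d)).card :=
    (Finset.sum_eq_sum_iff_of_le fun q _ => two_le_card_originalCorners hr ho q).1 hsum _
      (Finset.mem_univ _)
  rcases h : (faceNext σ d).snd with c | p
  · have hsub : {d, faceNext σ d, faceNext σ (faceNext σ d)} ⊆ originalCorners (faceOf σ d) :=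
      fun e he => mem_originalCorners.2 ⟨mem_faceDarts.1 (triple_subset_faceDarts d he), by
        simp only [Finset.mem_insert, Finset.mem_singleton] at he
        rcases he with rfl | rfl | rfl <;> simp only [hr.fst_faceNext, ha, hb, h, Sum.isLeft_inl]⟩
    have := Finset.card_le_card hsub
    rw [hr.card_triple fun h => hdigons.subset (show faceOf σ d ∈ digons σ from ⟨d, rfl, h⟩)]
      at this
    omega
  · exact ⟨p, rfl⟩

/-- In Euler's formula, faces of length two cost as much as components, and a face of length two
in a connected planarization leaves only two vertices. -/
theorem IsPlanarRotation.digons_eq_empty (hσ : IsPlanarRotation C.planarization σ)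
    (ho : IsOppositeAtCrossings σ) (hV : 3 ≤ Nat.card V)
    (hG : G.edgeSet.ncard + 8 = 4 * Nat.card V) :
    digons σ = ∅ ∧ faceCount C.planarization σ = G.edgeSet.ncard ∧
      3 * faceCount C.planarization σ = 2 * C.planarization.edgeSet.ncard := by
  obtain ⟨hr, heuler⟩ := hσ
  have hcomp := hr.card_isolated_add_card_digons_le
  have hlength := hr.three_mul_faceCount_le
  have hcorners := faceCount_le_ncard_edgeSet hr ho
  have hedges := C.ncard_edgeSet_planarization
  obtain ⟨⟨x, y⟩, hxy⟩ := Set.nonempty_of_ncard_ne_zero (s := C.planarization.edgeSet) (by omega)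
  have hisolated := card_isolated_lt (Γ := C.planarization) ⟨(x, y), hxy⟩
  change _ + (_ + {v | C.planarization.IsIsolated v}.ncard) = _ at heuler
  rw [Nat.card_sum] at heuler
  rcases (digons σ).eq_empty_or_nonempty with hempty | ⟨q, hq⟩
  · rw [hempty, Set.ncard_empty] at hlength
    exact ⟨hempty, by omega, by omega⟩
  · exfalso
    have hone : Nat.card C.planarization.ConnectedComponent = 1 := by
      classical
      have := Fintype.ofFinite V
      have := Fintype.ofFinite C.pairs
      have : Finite (Face σ) := Quotient.finite _
      have := (Set.ncard_pos (Set.toFinite _)).2 ⟨q, hq⟩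
      omega
    obtain ⟨d, -, hd⟩ := hq
    have := hr.card_le_two_of_digon hd hone
    rw [Nat.card_sum] at this
    omega

theorem IsPlanarRotation.isKiteTriangulation (hσ : IsPlanarRotation C.planarization σ)
    (ho : IsOppositeAtCrossings σ) (hV : 3 ≤ Nat.card V)
    (hG : G.edgeSet.ncard + 8 = 4 * Nat.card V) : IsKiteTriangulation σ := by
  obtain ⟨hdigons, hcorners, hlength⟩ := hσ.digons_eq_empty ho hV hG
  exact ⟨hσ.1, ho, hσ.1.triangle_of_three_mul_faceCount_eq hdigons hlength,
    fun _ _ _ => exists_crossing_of_faceCount_eq hσ.1 ho hcorners hdigons⟩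

end OptimalDrawing

theorem exists_eq_diagonalPair_of_mem_sides {q : Quad V} {a b : V} (h : s(a, b) ∈ sides q) :
    ∃ c d, diagonalPair q = s(s(a, c), s(b, d)) := by
  obtain ⟨q₁, q₂, q₃, q₄⟩ := q
  rw [mem_sides] at h
  simp only [diagonalPair]
  rcases h with h | h | h | h <;> rcases Sym2.eq_iff.1 h with ⟨rfl, rfl⟩ | ⟨rfl, rfl⟩
  · exact ⟨q₃, q₄, rfl⟩
  · exact ⟨q₄, q₃, Sym2.eq_swap⟩
  · exact ⟨q₄, q₁, by rw [Sym2.eq_swap (a := q₁), Sym2.eq_swap]⟩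
  · exact ⟨q₁, q₄, by rw [Sym2.eq_swap (a := q₁)]⟩
  · exact ⟨q₁, q₂, by rw [Sym2.eq_swap (a := q₁), Sym2.eq_swap (a := q₂)]⟩
  · exact ⟨q₂, q₁, by rw [Sym2.eq_swap (a := q₁), Sym2.eq_swap (a := q₂), Sym2.eq_swap]⟩
  · exact ⟨q₂, q₃, by rw [Sym2.eq_swap (a := q₂), Sym2.eq_swap]⟩
  · exact ⟨q₃, q₂, by rw [Sym2.eq_swap (a := q₂)]⟩

theorem mem_sides_of_planarization_adj {p : C.pairs} {q : Quad V} (hp : diagonalPair q = p.1)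
    {a b : V} (hab : C.planarization.Adj (Sum.inl a) (Sum.inl b))
    (ha : C.planarization.Adj (Sum.inr p) (Sum.inl a))
    (hb : C.planarization.Adj (Sum.inr p) (Sum.inl b)) : s(a, b) ∈ sides q := by
  obtain ⟨q₁, q₂, q₃, q₄⟩ := q
  have hne : a ≠ b := hab.1.ne
  have hmem : s(a, b) ∉ p.1 := hab.2 p.1 p.2
  rw [C.adj_inr_inl_iff hp.symm] at ha hb
  rw [← hp, mem_diagonalPair, mem_diagonals, not_or, Sym2.eq_iff, Sym2.eq_iff] at hmem
  simp only [mem_sides, Sym2.eq_iff]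
  rcases ha with rfl | rfl | rfl | rfl <;> rcases hb with rfl | rfl | rfl | rfl <;>
    simp at hne hmem ⊢

namespace IsKiteTriangulation

variable (hT : IsKiteTriangulation σ)
include hT

theorem exists_consecutive_of_faceNext {f : C.planarization.Dart} {p : C.pairs}
    (hp : (faceNext σ f).snd = Sum.inr p) :
    ∃ e : C.planarization.Dart, e.fst = Sum.inr p ∧ e.snd = f.snd ∧ (σ e).snd = f.fst := by
  refine ⟨(faceNext σ f).symm, hp, hT.isRotationSystem.fst_faceNext f, ?_⟩
  have hthird := hT.isRotationSystem.fst_faceNext (faceNext σ (faceNext σ f))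
  rw [hT.triangle] at hthird
  exact hthird.symm

theorem exists_faceNext_of_consecutive (e : C.planarization.Dart) :
    ∃ f : C.planarization.Dart,
      f.fst = (σ e).snd ∧ f.snd = e.snd ∧ (faceNext σ f).snd = e.fst := by
  have htriangle := hT.triangle e.symm
  have hthird := hT.isRotationSystem.fst_faceNext (faceNext σ (faceNext σ e.symm))
  rw [htriangle] at hthird
  refine ⟨faceNext σ (faceNext σ e.symm), ?_, hthird.symm, by rw [htriangle]; rfl⟩
  rw [hT.isRotationSystem.fst_faceNext, faceNext_symm]

theorem snd_apply_eq_or {p : C.pairs} {a b c d : V} (hp : p.1 = s(s(a, c), s(b, d)))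
    {e : C.planarization.Dart} (he : e.fst = Sum.inr p) (ha : e.snd = Sum.inl a) :
    (σ e).snd = Sum.inl b ∨ (σ e).snd = Sum.inl d := by
  have hfst : (σ e).fst = Sum.inr p := (hT.isRotationSystem.fst_apply e).trans he
  have hfst' : (σ (σ e)).fst = Sum.inr p := (hT.isRotationSystem.fst_apply _).trans hfst
  have hopposite : (σ (σ e)).snd = Sum.inl c :=
    hT.isOpposite e p a c he ha (hp ▸ Sym2.mem_mk_left _ _)
  obtain ⟨v, hv⟩ := exists_snd_eq_inl hfst
  have hadj : C.planarization.Adj (Sum.inr p) (Sum.inl v) := hfst ▸ hv ▸ (σ e).adj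
  rcases (C.adj_inr_inl_iff hp).1 hadj with rfl | rfl | rfl | rfl
  · exact absurd (eq_of_fst_eq_of_snd_eq (hfst.trans he.symm) (hv.trans ha.symm))
      (hT.isOpposite.apply_ne he)
  · exact Or.inl hv
  · exact absurd (eq_of_fst_eq_of_snd_eq (hfst'.trans hfst.symm) (hopposite.trans hv.symm))
      (hT.isOpposite.apply_ne hfst)
  · exact Or.inr hv

theorem exists_dart_of_crossing {p : C.pairs} {a b c d : V} (hp : p.1 = s(s(a, c), s(b, d))) :
    ∃ f : C.planarization.Dart, f.fst = Sum.inl a ∧ f.snd = Sum.inl b ∧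
      ((faceNext σ f).snd = Sum.inr p ∨ (faceNext σ f.symm).snd = Sum.inr p) := by
  have hac : s(a, c) ∈ p.1 := hp ▸ Sym2.mem_mk_left _ _
  have hbd : s(d, b) ∈ p.1 := hp ▸ Sym2.eq_swap (a := d) ▸ Sym2.mem_mk_right _ _
  let e : C.planarization.Dart := ⟨(Sum.inr p, Sum.inl a), s(a, c), hac, Sym2.mem_mk_left _ _⟩
  have hfst (i : C.planarization.Dart) (hi : i.fst = Sum.inr p) : (σ i).fst = Sum.inr p :=
    (hT.isRotationSystem.fst_apply i).trans hi
  rcases hT.snd_apply_eq_or hp (e := e) rfl rfl with hb | hd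
  · obtain ⟨f, hf₁, hf₂, hf₃⟩ := hT.exists_faceNext_of_consecutive e
    exact ⟨f.symm, hf₂, hf₁.trans hb, Or.inr hf₃⟩
  · have hc : (σ (σ e)).snd = Sum.inl c := hT.isOpposite e p a c rfl rfl hac
    have hb : (σ (σ (σ e))).snd = Sum.inl b := hT.isOpposite _ p d b (hfst e rfl) hd hbd
    have ha : (σ (σ (σ (σ e)))).snd = Sum.inl a :=
      hT.isOpposite _ p c a (hfst _ (hfst e rfl)) hc (Sym2.eq_swap ▸ hac)
    obtain ⟨f, hf₁, hf₂, hf₃⟩ := hT.exists_faceNext_of_consecutive (σ (σ (σ e)))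
    exact ⟨f, hf₁.trans ha, hf₂.trans hb, Or.inl (hf₃.trans (hfst _ (hfst _ (hfst e rfl))))⟩

theorem planarization_adj_of_mem_sides {p : C.pairs} {q : Quad V} (hp : diagonalPair q = p.1)
    {a b : V} (h : s(a, b) ∈ sides q) : C.planarization.Adj (Sum.inl a) (Sum.inl b) := by
  obtain ⟨c, d, hq⟩ := exists_eq_diagonalPair_of_mem_sides h
  obtain ⟨f, hf₁, hf₂, -⟩ := hT.exists_dart_of_crossing (hp.symm.trans hq)
  exact hf₁ ▸ hf₂ ▸ f.adj

theorem mem_sides_of_faceNext {d : C.planarization.Dart} {a b : V} (ha : d.fst = Sum.inl a)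
    (hb : d.snd = Sum.inl b) {p : C.pairs} {q : Quad V} (hq : diagonalPair q = p.1)
    (hp : (faceNext σ d).snd = Sum.inr p) : s(a, b) ∈ sides q := by
  obtain ⟨e, he₁, he₂, he₃⟩ := hT.exists_consecutive_of_faceNext hp
  have hfst : (σ e).fst = Sum.inr p := (hT.isRotationSystem.fst_apply e).trans he₁
  exact mem_sides_of_planarization_adj hq (ha ▸ hb ▸ d.adj)
    (hfst ▸ (he₃.trans ha) ▸ (σ e).adj) (he₁ ▸ (he₂.trans hb) ▸ e.adj)

theorem mem_sides_iff {d : C.planarization.Dart} {a b : V} (ha : d.fst = Sum.inl a)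
    (hb : d.snd = Sum.inl b) {p : C.pairs} {q : Quad V} (hq : diagonalPair q = p.1) :
    s(a, b) ∈ sides q ↔
      (faceNext σ d).snd = Sum.inr p ∨ (faceNext σ d.symm).snd = Sum.inr p := by
  refine ⟨fun h => ?_, fun h => h.elim (hT.mem_sides_of_faceNext ha hb hq) fun h => ?_⟩
  · obtain ⟨c, c', hc⟩ := exists_eq_diagonalPair_of_mem_sides h
    obtain ⟨f, hf₁, hf₂, hf⟩ := hT.exists_dart_of_crossing (hq.symm.trans hc)
    rwa [eq_of_fst_eq_of_snd_eq (hf₁.trans ha.symm) (hf₂.trans hb.symm)] at hf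
  · rw [Sym2.eq_swap]
    exact hT.mem_sides_of_faceNext (d := d.symm) hb ha hq h

theorem faceNext_snd_ne {d : C.planarization.Dart} {p : C.pairs}
    (hp : (faceNext σ d).snd = Sum.inr p) : (faceNext σ d.symm).snd ≠ Sum.inr p := by
  intro hp'
  obtain ⟨e, he₁, he₂, he₃⟩ := hT.exists_consecutive_of_faceNext hp
  obtain ⟨f, hf₁, hf₂, hf₃⟩ := hT.exists_consecutive_of_faceNext hp'
  have hfst (i : C.planarization.Dart) (hi : i.fst = Sum.inr p) : (σ i).fst = Sum.inr p :=
    (hT.isRotationSystem.fst_apply i).trans hi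
  have hef : σ e = f := eq_of_fst_eq_of_snd_eq ((hfst e he₁).trans hf₁.symm) (he₃.trans hf₂.symm)
  have hfe : σ f = e := eq_of_fst_eq_of_snd_eq ((hfst f hf₁).trans he₁.symm) (hf₃.trans he₂.symm)
  exact hT.isOpposite.apply_apply_ne he₁ (by rw [hef, hfe])

open Classical in
theorem count_bind_sides [Fintype C.pairs] {q : C.pairs → Quad V}
    (hq : ∀ p, diagonalPair (q p) = p.1) (a b : V) :
    ((Finset.univ.val.map q).bind sides).count s(a, b) =
      if C.planarization.Adj (Sum.inl a) (Sum.inl b) then 2 else 0 := by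
  have hcount (p : C.pairs) :
      (sides (q p)).count s(a, b) = if s(a, b) ∈ sides (q p) then 1 else 0 :=
    Multiset.count_eq_of_nodup (C.nodup_sides ((hq p).symm ▸ p.2))
  have hsum : ((Finset.univ.val.map q).bind sides).count s(a, b) =
      ∑ p : C.pairs, if s(a, b) ∈ sides (q p) then 1 else 0 := by
    rw [Multiset.bind_map, Multiset.count_bind]
    exact Finset.sum_congr rfl fun p _ => hcount p
  rw [hsum, Finset.sum_boole, Nat.cast_id]
  split_ifs with hadj
  · let d : C.planarization.Dart := ⟨(Sum.inl a, Sum.inl b), hadj⟩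
    obtain ⟨p, hp⟩ := hT.exists_crossing d a b rfl rfl
    obtain ⟨r, hr⟩ := hT.exists_crossing d.symm b a rfl rfl
    refine Finset.card_eq_two.2 ⟨p, r, fun h => hT.faceNext_snd_ne hp (h ▸ hr), ?_⟩
    ext t
    rw [Finset.mem_filter_univ, hT.mem_sides_iff (d := d) rfl rfl (hq t), hp, hr,
      Sum.inr.injEq, Sum.inr.injEq, eq_comm, eq_comm (a := r), Finset.mem_insert,
      Finset.mem_singleton]
  · exact Finset.card_eq_zero.2 (Finset.filter_eq_empty_iff.2 fun p _ h =>
      hadj (hT.planarization_adj_of_mem_sides (hq p) h))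

theorem hasKiteCover [Finite V] : HasKiteCover G := by
  classical
  have := Fintype.ofFinite V
  have := Fintype.ofFinite C.pairs
  choose q hq using C.exists_diagonalPair_eq
  refine ⟨Finset.univ.val.map q, fun e => ?_⟩
  induction e using Sym2.ind with | _ a b => ?_
  rw [bind_weight, Multiset.count_add, Multiset.count_nsmul, hT.count_bind_sides hq,
    C.count_bind_diagonals hq]
  by_cases hcrossed : ∃ p ∈ C.pairs, s(a, b) ∈ p
  · obtain ⟨p, hp, hmem⟩ := hcrossed
    have hnadj : ¬ C.planarization.Adj (Sum.inl a) (Sum.inl b) := fun h => h.2 p hp hmem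
    rw [if_neg hnadj, if_pos ⟨p, hp, hmem⟩, if_pos (C.isEdge p hp _ hmem)]
  · have hadj : C.planarization.Adj (Sum.inl a) (Sum.inl b) ↔ s(a, b) ∈ G.edgeSet :=
      ⟨fun h => h.1, fun h => ⟨h, fun p hp hmem => hcrossed ⟨p, hp, hmem⟩⟩⟩
    simp only [hcrossed, hadj, if_false, mul_zero, add_zero]

end IsKiteTriangulation

theorem IsOptimalOnePlanar.hasKiteCover [Finite V] (h : IsOptimalOnePlanar G) :
    HasKiteCover G := by
  obtain ⟨hV, ⟨C, σ, hσ, ho⟩, hG⟩ := h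
  exact (hσ.isKiteTriangulation ho hV hG).hasKiteCover

end KiteTriangulation

/-! ### Optimal 1-planar graphs from quadrangulations -/

section KiteMap

/-- A quadrangulation of an oriented closed surface with vertex set `V` and set of faces `ι`. The
corners `(p, 0), …, (p, 3)` of a face `p` are in cyclic order and correspond to the sides of `p`,
where the side `(p, i)` leads from the corner `(p, i)` to the corner `(p, i + 1)`. Each side has a
mate, which is the same edge in opposite direction as a side of the face next to it. The sides and
diagonals of the faces are the edges of a simple graph, and crossing to the mate of a side and
going on to its end runs through all corners at a vertex. -/
structure KiteMap (V : Type u) (ι : Type v) where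
  vertex : ι × Fin 4 → V
  mate : ι × Fin 4 → ι × Fin 4
  mate_mate : ∀ c, mate (mate c) = c
  vertex_mate : ∀ c, vertex (mate c) = vertex (c.1, c.2 + 1)
  vertex_injective : ∀ p i j, vertex (p, i) = vertex (p, j) → i = j
  vertex_surjective : ∀ a, ∃ c, vertex c = a
  side_injective : ∀ c d, vertex c = vertex d →
    vertex (c.1, c.2 + 1) = vertex (d.1, d.2 + 1) → c = d
  diagonal_injective : ∀ c d, vertex c = vertex d →
    vertex (c.1, c.2 + 2) = vertex (d.1, d.2 + 2) → c = d
  side_ne_diagonal : ∀ c d, vertex c = vertex d → vertex (c.1, c.2 + 1) ≠ vertex (d.1, d.2 + 2)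
  exists_iterate : ∀ c d, vertex c = vertex d →
    ∃ n, (fun c => ((mate c).1, (mate c).2 + 1))^[n] c = d

theorem add_two_add_two (i : Fin 4) : i + 2 + 2 = i := by
  revert i
  decide

theorem eq_of_sameCycle {α β : Type*} {π : Equiv.Perm α} {f : α → β} (hf : ∀ x, f (π x) = f x)
    {x y : α} (h : π.SameCycle x y) : f x = f y := by
  obtain ⟨n, rfl⟩ := h
  induction n using Int.induction_on with
  | zero => rfl
  | succ n ih => rw [ih, add_comm, zpow_one_add, Equiv.Perm.mul_apply, hf]
  | pred n ih =>
    rw [ih, ← hf ((π ^ (-(n : ℤ) - 1)) x), ← Equiv.Perm.mul_apply, ← zpow_one_add,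
      add_sub_cancel]

theorem sameCycle_apply {α : Type*} (π : Equiv.Perm α) (x : α) : π.SameCycle x (π x) :=
  Equiv.Perm.sameCycle_apply_right.2 (Equiv.Perm.SameCycle.refl _ _)

theorem sameCycle_of_forall_add_one {α : Type*} {π : Equiv.Perm α} {n : ℕ} {f : Fin (n + 1) → α}
    (h : ∀ i, π.SameCycle (f i) (f (i + 1))) (i j : Fin (n + 1)) : π.SameCycle (f i) (f j) := by
  have hzero (i : Fin (n + 1)) : π.SameCycle (f 0) (f i) := by
    induction i using Fin.induction with
    | zero => exact Equiv.Perm.SameCycle.refl _ _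
    | succ i ih => exact ih.trans (Fin.coeSucc_eq_succ ▸ h i.castSucc)
  exact (hzero i).symm.trans (hzero j)

theorem reachable_of_forall_adj {V : Type u} {W : Type v} {G : SimpleGraph V} {H : SimpleGraph W}
    {f : V → W} (hf : ∀ a b, G.Adj a b → H.Reachable (f a) (f b)) {a b : V}
    (h : G.Reachable a b) : H.Reachable (f a) (f b) := by
  simp only [SimpleGraph.reachable_iff_reflTransGen] at hf h ⊢
  exact h.lift' f hf

namespace KiteMap

variable {V : Type u} {ι : Type v} (M : KiteMap V ι)

/-- The graph whose edges are the sides and the diagonals of the faces. -/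
def graph : SimpleGraph V where
  Adj a b := ∃ c, M.vertex c = a ∧ (M.vertex (c.1, c.2 + 1) = b ∨ M.vertex (c.1, c.2 + 2) = b)
  symm := ⟨by
    rintro _ _ ⟨c, rfl, rfl | rfl⟩
    · exact ⟨M.mate c, M.vertex_mate c, Or.inl (by rw [← M.vertex_mate, M.mate_mate])⟩
    · exact ⟨(c.1, c.2 + 2), rfl, Or.inr (by rw [add_two_add_two])⟩⟩
  loopless := ⟨by
    rintro _ ⟨⟨p, i⟩, rfl, h | h⟩
    · simpa using M.vertex_injective p _ _ h
    · simpa using M.vertex_injective p _ _ h⟩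

instance [Fintype ι] [DecidableEq V] : DecidableRel M.graph.Adj := fun a b =>
  inferInstanceAs (Decidable
    (∃ c, M.vertex c = a ∧ (M.vertex (c.1, c.2 + 1) = b ∨ M.vertex (c.1, c.2 + 2) = b)))

/-- The boundary of a face. -/
def quad (p : ι) : Quad V :=
  (M.vertex (p, 0), M.vertex (p, 1), M.vertex (p, 2), M.vertex (p, 3))

variable {M}

theorem adj_side (c : ι × Fin 4) : M.graph.Adj (M.vertex c) (M.vertex (c.1, c.2 + 1)) :=
  ⟨c, rfl, Or.inl rfl⟩

theorem adj_diagonal (c : ι × Fin 4) : M.graph.Adj (M.vertex c) (M.vertex (c.1, c.2 + 2)) :=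
  ⟨c, rfl, Or.inr rfl⟩

theorem vertex_mate_add_one (c : ι × Fin 4) :
    M.vertex ((M.mate c).1, (M.mate c).2 + 1) = M.vertex c := by
  rw [← M.vertex_mate, M.mate_mate]

theorem mem_diagonalPair_quad {p : ι} {e : Sym2 V} :
    e ∈ diagonalPair (M.quad p) ↔ ∃ i, e = s(M.vertex (p, i), M.vertex (p, i + 2)) := by
  rw [quad, diagonalPair, Sym2.mem_iff]
  constructor
  · rintro (rfl | rfl)
    · exact ⟨0, rfl⟩
    · exact ⟨1, rfl⟩
  · rintro ⟨i, rfl⟩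
    fin_cases i
    · exact Or.inl rfl
    · exact Or.inr rfl
    · exact Or.inl Sym2.eq_swap
    · exact Or.inr Sym2.eq_swap

theorem mk_mem_diagonalPair_quad {p : ι} {a b : V} :
    s(a, b) ∈ diagonalPair (M.quad p) ↔
      ∃ i, M.vertex (p, i) = a ∧ M.vertex (p, i + 2) = b := by
  rw [mem_diagonalPair_quad]
  constructor
  · rintro ⟨i, h⟩
    rcases Sym2.eq_iff.1 h with ⟨rfl, rfl⟩ | ⟨rfl, rfl⟩
    · exact ⟨i, rfl, rfl⟩
    · exact ⟨i + 2, rfl, by rw [add_two_add_two]⟩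
  · rintro ⟨i, rfl, rfl⟩
    exact ⟨i, rfl⟩

theorem eq_of_mem_diagonalPair_quad {p q : ι} {e : Sym2 V} (hp : e ∈ diagonalPair (M.quad p))
    (hq : e ∈ diagonalPair (M.quad q)) : p = q := by
  obtain ⟨i, rfl⟩ := mem_diagonalPair_quad.1 hp
  obtain ⟨j, h₁, h₂⟩ := mk_mem_diagonalPair_quad.1 hq
  exact congrArg Prod.fst (M.diagonal_injective (p, i) (q, j) h₁.symm h₂.symm)

variable (M) in
/-- The crossing pattern in which the two diagonals of each face cross. -/
def pattern : CrossingPattern M.graph where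
  pairs := Set.range fun p => diagonalPair (M.quad p)
  isEdge := by
    rintro _ ⟨p, rfl⟩ e he
    obtain ⟨i, rfl⟩ := mem_diagonalPair_quad.1 he
    exact adj_diagonal (p, i)
  disjoint := by
    rintro e f ⟨p, hp⟩ w he hf
    have hinj {i j : Fin 4} (hij : i ≠ j) : M.vertex (p, i) ≠ M.vertex (p, j) := fun h =>
      hij (M.vertex_injective p i j h)
    rcases Sym2.eq_iff.1 hp with ⟨rfl, rfl⟩ | ⟨rfl, rfl⟩ <;>
    · rcases Sym2.mem_iff.1 he with rfl | rfl <;> rcases Sym2.mem_iff.1 hf with hf | hf <;>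
        exact hinj (by decide) hf
  crossedOnce := by
    rintro _ ⟨p, rfl⟩ _ ⟨q, rfl⟩ e hp hq
    rw [eq_of_mem_diagonalPair_quad hp hq]

variable (M) in
/-- The crossing in a face, as a vertex of the planarization. -/
def crossing (p : ι) : M.pattern.pairs := ⟨diagonalPair (M.quad p), p, rfl⟩

theorem crossing_bijective : Function.Bijective M.crossing := by
  constructor
  · intro p q hpq
    have h : diagonalPair (M.quad p) = diagonalPair (M.quad q) := congrArg Subtype.val hpq
    have hmem : s(M.vertex (p, 0), M.vertex (p, 2)) ∈ diagonalPair (M.quad p) :=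
      Sym2.mem_mk_left _ _
    exact eq_of_mem_diagonalPair_quad hmem (h ▸ hmem)
  · rintro ⟨_, p, rfl⟩
    exact ⟨p, rfl⟩

theorem planarization_adj_inl_inl {a b : V} :
    M.pattern.planarization.Adj (Sum.inl a) (Sum.inl b) ↔
      ∃ c, M.vertex c = a ∧ M.vertex (c.1, c.2 + 1) = b := by
  constructor
  · rintro ⟨⟨c, rfl, rfl | rfl⟩, huncrossed⟩
    · exact ⟨c, rfl, rfl⟩
    · exact absurd (mem_diagonalPair_quad.2 ⟨c.2, rfl⟩) (huncrossed _ ⟨c.1, rfl⟩)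
  · rintro ⟨c, rfl, rfl⟩
    refine ⟨adj_side c, ?_⟩
    rintro _ ⟨q, rfl⟩ hq
    obtain ⟨j, h₁, h₂⟩ := mk_mem_diagonalPair_quad.1 hq
    exact M.side_ne_diagonal c (q, j) h₁.symm h₂.symm

theorem planarization_adj_inl_inr {a : V} {p : ι} :
    M.pattern.planarization.Adj (Sum.inl a) (Sum.inr (M.crossing p)) ↔
      ∃ i, M.vertex (p, i) = a := by
  constructor
  · rintro ⟨e, he, ha⟩
    obtain ⟨b, rfl⟩ := Sym2.mem_iff_exists.1 ha
    obtain ⟨i, rfl, -⟩ := mk_mem_diagonalPair_quad.1 he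
    exact ⟨i, rfl⟩
  · rintro ⟨i, rfl⟩
    exact ⟨_, mem_diagonalPair_quad.2 ⟨i, rfl⟩, Sym2.mem_mk_left _ _⟩

end KiteMap
end KiteMap

namespace KiteMap

section Rotation

variable {V : Type u} {ι : Type v} {M : KiteMap V ι}

variable (M) in
/-- The darts of the triangle spanned by a side of a face and the crossing in this face. -/
def dart : (ι × Fin 4) × Fin 3 → M.pattern.planarization.Dart
  | (c, 0) => ⟨(Sum.inr (M.crossing c.1), Sum.inl (M.vertex c)),
      (planarization_adj_inl_inr.2 ⟨c.2, rfl⟩).symm⟩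
  | (c, 1) => ⟨(Sum.inl (M.vertex c), Sum.inl (M.vertex (c.1, c.2 + 1))),
      planarization_adj_inl_inl.2 ⟨c, rfl, rfl⟩⟩
  | (c, 2) => ⟨(Sum.inl (M.vertex (c.1, c.2 + 1)), Sum.inr (M.crossing c.1)),
      planarization_adj_inl_inr.2 ⟨c.2 + 1, rfl⟩⟩

theorem dart_injective : Function.Injective M.dart := by
  rintro ⟨⟨p, i⟩, k⟩ ⟨⟨q, j⟩, l⟩ heq
  have hfst : (M.dart ((p, i), k)).fst = (M.dart ((q, j), l)).fst := by rw [heq]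
  have hsnd : (M.dart ((p, i), k)).snd = (M.dart ((q, j), l)).snd := by rw [heq]
  fin_cases k <;> fin_cases l <;>
    simp only [dart, Sum.inl.injEq, Sum.inr.injEq, reduceCtorEq] at hfst hsnd
  · obtain rfl := crossing_bijective.1 hfst
    rw [M.vertex_injective p i j hsnd]
  · rw [M.side_injective (p, i) (q, j) hfst hsnd]
  · obtain rfl := crossing_bijective.1 hsnd
    rw [add_right_cancel (M.vertex_injective p _ _ hfst)]

theorem dart_surjective : Function.Surjective M.dart := by
  rintro ⟨⟨a | p, b | q⟩, hadj⟩
  · obtain ⟨c, rfl, rfl⟩ := planarization_adj_inl_inl.1 hadj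
    exact ⟨(c, 1), rfl⟩
  · obtain ⟨q, rfl⟩ := crossing_bijective.2 q
    obtain ⟨i, rfl⟩ := planarization_adj_inl_inr.1 hadj
    exact ⟨((q, i - 1), 2), eq_of_fst_eq_of_snd_eq (by simp [dart]) rfl⟩
  · obtain ⟨p, rfl⟩ := crossing_bijective.2 p
    obtain ⟨i, rfl⟩ := planarization_adj_inl_inr.1 hadj.symm
    exact ⟨((p, i), 0), rfl⟩
  · exact hadj.elim

variable (M) in
/-- Every dart of the planarization belongs to exactly one of the triangles. -/
noncomputable def dartEquiv : (ι × Fin 4) × Fin 3 ≃ M.pattern.planarization.Dart :=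
  Equiv.ofBijective M.dart ⟨dart_injective, dart_surjective⟩

theorem dartEquiv_symm_dart (x : (ι × Fin 4) × Fin 3) : M.dartEquiv.symm (M.dart x) = x :=
  M.dartEquiv.symm_apply_apply x

variable (M) in
/-- The permutation of the darts that runs along the triangles. -/
noncomputable def facePerm : Equiv.Perm M.pattern.planarization.Dart :=
  M.dartEquiv.permCongr (Equiv.prodCongr (Equiv.refl _) (Equiv.addRight (1 : Fin 3)))

theorem facePerm_dart (c : ι × Fin 4) (k : Fin 3) :
    M.facePerm (M.dart (c, k)) = M.dart (c, k + 1) := by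
  rw [facePerm, Equiv.permCongr_apply, dartEquiv_symm_dart]
  rfl

theorem sameCycle_facePerm_dart {c d : ι × Fin 4} {k l : Fin 3} :
    M.facePerm.SameCycle (M.dart (c, k)) (M.dart (d, l)) ↔ c = d := by
  constructor
  · intro h
    have hcorner (e) : (M.dartEquiv.symm (M.facePerm e)).1 = (M.dartEquiv.symm e).1 := by
      obtain ⟨⟨c, k⟩, rfl⟩ := dart_surjective e
      rw [facePerm_dart, dartEquiv_symm_dart, dartEquiv_symm_dart]
    simpa only [dartEquiv_symm_dart] using
      eq_of_sameCycle (f := fun e => (M.dartEquiv.symm e).1) hcorner h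
  · rintro rfl
    exact sameCycle_of_forall_add_one (f := fun k => M.dart (c, k))
      (fun k => facePerm_dart c k ▸ sameCycle_apply _ _) k l

variable (M) in
/-- The rotation system of the planarization whose faces are the triangles. -/
noncomputable def rotation : Equiv.Perm M.pattern.planarization.Dart :=
  M.facePerm * reversePerm _

theorem faceNext_rotation : faceNext M.rotation = M.facePerm := by
  ext1 d
  exact congrArg M.facePerm d.symm_symm

theorem rotation_dart_zero (p : ι) (i : Fin 4) :
    M.rotation (M.dart ((p, i), 0)) = M.dart ((p, i - 1), 0) := by
  have hsymm : (M.dart ((p, i), 0)).symm = M.dart ((p, i - 1), 2) :=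
    eq_of_fst_eq_of_snd_eq (by simp [dart]) rfl
  rw [← faceNext_symm, hsymm, faceNext_rotation, facePerm_dart]
  rfl

theorem rotation_dart_one (c : ι × Fin 4) :
    M.rotation (M.dart (c, 1)) = M.dart (M.mate c, 2) := by
  have hsymm : (M.dart (c, 1)).symm = M.dart (M.mate c, 1) :=
    eq_of_fst_eq_of_snd_eq (congrArg Sum.inl (M.vertex_mate c).symm)
      (congrArg Sum.inl (vertex_mate_add_one c).symm)
  rw [← faceNext_symm, hsymm, faceNext_rotation, facePerm_dart]
  rfl

theorem rotation_dart_two (c : ι × Fin 4) :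
    M.rotation (M.dart (c, 2)) = M.dart ((c.1, c.2 + 1), 1) := by
  have hsymm : (M.dart (c, 2)).symm = M.dart ((c.1, c.2 + 1), 0) := rfl
  rw [← faceNext_symm, hsymm, faceNext_rotation, facePerm_dart]
  rfl

theorem fst_rotation (d : M.pattern.planarization.Dart) : (M.rotation d).fst = d.fst := by
  obtain ⟨⟨⟨p, i⟩, k⟩, rfl⟩ := dart_surjective d
  fin_cases k
  · change (M.rotation (M.dart ((p, i), 0))).fst = _
    rw [rotation_dart_zero]
    rfl
  · change (M.rotation (M.dart ((p, i), 1))).fst = _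
    rw [rotation_dart_one]
    exact congrArg Sum.inl (vertex_mate_add_one (p, i))
  · change (M.rotation (M.dart ((p, i), 2))).fst = _
    rw [rotation_dart_two]
    rfl

theorem sameCycle_rotation_dart_zero (p : ι) (i j : Fin 4) :
    M.rotation.SameCycle (M.dart ((p, i), 0)) (M.dart ((p, j), 0)) := by
  refine sameCycle_of_forall_add_one (f := fun i => M.dart ((p, i), 0)) (fun i => ?_) i j
  have h := sameCycle_apply M.rotation (M.dart ((p, i + 1), 0))
  rw [rotation_dart_zero, add_sub_cancel_right] at h
  exact h.symm

theorem sameCycle_rotation_dart_two_dart_one (c : ι × Fin 4) :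
    M.rotation.SameCycle (M.dart (c, 2)) (M.dart ((c.1, c.2 + 1), 1)) :=
  rotation_dart_two c ▸ sameCycle_apply _ _

theorem sameCycle_rotation_dart_one {c d : ι × Fin 4} (h : M.vertex c = M.vertex d) :
    M.rotation.SameCycle (M.dart (c, 1)) (M.dart (d, 1)) := by
  obtain ⟨n, rfl⟩ := M.exists_iterate c d h
  clear h
  induction n generalizing c with
  | zero => exact Equiv.Perm.SameCycle.refl _ _
  | succ n ih =>
    have hmate : M.rotation.SameCycle (M.dart (c, 1)) (M.dart (M.mate c, 2)) :=
      rotation_dart_one c ▸ sameCycle_apply _ _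
    exact (hmate.trans (sameCycle_rotation_dart_two_dart_one _)).trans ih

theorem isRotationSystem : IsRotationSystem M.pattern.planarization M.rotation := by
  refine fun d e => ⟨?_, fun heq => ?_⟩
  · exact eq_of_sameCycle (f := fun d : M.pattern.planarization.Dart => d.fst) fst_rotation
  obtain ⟨⟨⟨p, i⟩, k⟩, rfl⟩ := dart_surjective d
  obtain ⟨⟨⟨q, j⟩, l⟩, rfl⟩ := dart_surjective e
  have htwo := sameCycle_rotation_dart_two_dart_one (M := M)
  fin_cases k <;> fin_cases l <;>
    simp only [dart, Sum.inl.injEq, Sum.inr.injEq, reduceCtorEq] at heq ⊢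
  · obtain rfl := crossing_bijective.1 heq
    exact sameCycle_rotation_dart_zero p i j
  · exact sameCycle_rotation_dart_one heq
  · exact (sameCycle_rotation_dart_one heq).trans (htwo (q, j)).symm
  · exact (htwo (p, i)).trans (sameCycle_rotation_dart_one heq)
  · exact ((htwo (p, i)).trans (sameCycle_rotation_dart_one heq)).trans (htwo (q, j)).symm

theorem isOppositeAtCrossings : IsOppositeAtCrossings M.rotation := by
  have hopposite : ∀ i : Fin 4, i - 1 - 1 = i + 2 := by decide
  intro d r a b hr ha hab
  obtain ⟨⟨⟨p, i⟩, k⟩, rfl⟩ := dart_surjective d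
  fin_cases k <;> simp only [dart, Sum.inl.injEq, Sum.inr.injEq, reduceCtorEq] at hr ha
  subst hr ha
  obtain ⟨j, hj, rfl⟩ := mk_mem_diagonalPair_quad.1 hab
  obtain rfl := M.vertex_injective p j i hj
  change (M.rotation (M.rotation (M.dart ((p, j), 0)))).snd = _
  rw [rotation_dart_zero, rotation_dart_zero, hopposite]
  rfl

theorem faceCount_rotation : faceCount M.pattern.planarization M.rotation = 4 * Nat.card ι := by
  have hbij : Function.Bijective fun c => faceOf M.rotation (M.dart (c, 0)) := by
    constructor
    · intro c d h
      exact sameCycle_facePerm_dart.1 (faceNext_rotation ▸ Quotient.exact h)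
    · intro q
      obtain ⟨e, rfl⟩ : ∃ e, faceOf M.rotation e = q := Quotient.exists_rep q
      obtain ⟨⟨c, k⟩, rfl⟩ := dart_surjective e
      exact ⟨c, Quotient.sound (show (faceNext M.rotation).SameCycle _ _ from
        faceNext_rotation ▸ sameCycle_facePerm_dart.2 rfl)⟩
  rw [← Nat.card_fin 4, mul_comm, ← Nat.card_prod]
  exact (Nat.card_congr (Equiv.ofBijective _ hbij)).symm

end Rotation

section Planarity

variable {V : Type u} {ι : Type v} {M : KiteMap V ι}

theorem planarization_connected (hM : M.graph.Connected) :
    M.pattern.planarization.Connected := by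
  have hinl (a b : V) : M.pattern.planarization.Reachable (Sum.inl a) (Sum.inl b) := by
    refine reachable_of_forall_adj (f := Sum.inl) ?_ (hM.preconnected a b)
    rintro _ _ ⟨c, rfl, rfl | rfl⟩
    · exact (planarization_adj_inl_inl.2 ⟨c, rfl, rfl⟩).reachable
    · exact (planarization_adj_inl_inr.2 ⟨c.2, rfl⟩).reachable.trans
        (planarization_adj_inl_inr.2 ⟨c.2 + 2, rfl⟩).symm.reachable
  obtain ⟨v⟩ := hM.nonempty
  refine (SimpleGraph.connected_iff_exists_forall_reachable _).2 ⟨Sum.inl v, ?_⟩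
  rintro (a | r)
  · exact hinl v a
  · obtain ⟨p, rfl⟩ := crossing_bijective.2 r
    exact (hinl v (M.vertex (p, 0))).trans (planarization_adj_inl_inr.2 ⟨0, rfl⟩).reachable

theorem exists_planarization_adj (x : V ⊕ M.pattern.pairs) :
    ∃ y, M.pattern.planarization.Adj x y := by
  rcases x with a | r
  · obtain ⟨c, rfl⟩ := M.vertex_surjective a
    exact ⟨_, planarization_adj_inl_inr.2 ⟨c.2, rfl⟩⟩
  · obtain ⟨p, rfl⟩ := crossing_bijective.2 r
    exact ⟨_, (planarization_adj_inl_inr.2 ⟨0, rfl⟩).symm⟩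

theorem card_pairs_pattern : Nat.card M.pattern.pairs = Nat.card ι :=
  (Nat.card_congr (Equiv.ofBijective _ crossing_bijective)).symm

variable [Finite V]

theorem ncard_edgeSet_planarization_pattern :
    M.pattern.planarization.edgeSet.ncard = 6 * Nat.card ι := by
  classical
  have := Fintype.ofFinite V
  have := Fintype.ofFinite M.pattern.pairs
  have hdarts : Nat.card M.pattern.planarization.Dart = 12 * Nat.card ι := by
    rw [← Nat.card_congr M.dartEquiv, Nat.card_prod, Nat.card_prod, Nat.card_fin, Nat.card_fin]
    ring
  rw [Nat.card_eq_fintype_card, SimpleGraph.dart_card_eq_twice_card_edges] at hdarts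
  rw [← SimpleGraph.coe_edgeFinset, Set.ncard_coe_finset]
  omega

theorem isPlanarRotation (hM : M.graph.Connected) (hcard : Nat.card V = Nat.card ι + 2) :
    IsPlanarRotation M.pattern.planarization M.rotation := by
  refine ⟨isRotationSystem, ?_⟩
  have hisolated : {x | ∀ y, ¬ M.pattern.planarization.Adj x y} = ∅ :=
    Set.eq_empty_iff_forall_notMem.2 fun x hx => (exists_planarization_adj x).elim hx
  have hcomponent : Nat.card M.pattern.planarization.ConnectedComponent = 1 := by
    have hconn := planarization_connected hM
    have := hconn.preconnected.subsingleton_connectedComponent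
    obtain ⟨x⟩ := hconn.nonempty
    exact Nat.card_eq_one_iff_unique.2 ⟨this, ⟨M.pattern.planarization.connectedComponentMk x⟩⟩
  rw [faceCount_rotation, hisolated, Set.ncard_empty, hcomponent,
    ncard_edgeSet_planarization_pattern, Nat.card_sum, card_pairs_pattern, hcard]
  ring

/-- The equation between the numbers of vertices and faces says that the surface is a sphere. -/
theorem isOptimalOnePlanar (hM : M.graph.Connected) (hcard : Nat.card V = Nat.card ι + 2)
    (hV : 3 ≤ Nat.card V) : IsOptimalOnePlanar M.graph := by
  refine ⟨hV, ⟨M.pattern, M.rotation, isPlanarRotation hM hcard, isOppositeAtCrossings⟩, ?_⟩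
  have hedges := M.pattern.ncard_edgeSet_planarization
  rw [ncard_edgeSet_planarization_pattern, card_pairs_pattern] at hedges
  omega

end Planarity

end KiteMap

/-! ### Connectivity and the example -/

section Connectedness

variable {V : Type u} {G : SimpleGraph V}

theorem connected_of_forall_eq_or_adj_or_exists (v : V)
    (h : ∀ w, w = v ∨ G.Adj v w ∨ ∃ z, G.Adj v z ∧ G.Adj z w) : G.Connected := by
  have hv (w : V) : G.Reachable v w := by
    obtain rfl | h | ⟨z, hvz, hzw⟩ := h w
    · exact SimpleGraph.Reachable.refl _
    · exact h.reachable
    · exact hvz.reachable.trans hzw.reachable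
  exact { preconnected := fun a b => (hv a).symm.trans (hv b), nonempty := ⟨v⟩ }

theorem isKConnected_of_forall_ne_adj [Finite V] {k : ℕ} (hk : k < Nat.card V)
    (hG : ∀ u v, u ≠ v → G.Adj u v) : IsKConnected k G := by
  refine ⟨hk, fun S hS => ?_⟩
  obtain ⟨v, hv⟩ : ∃ v, v ∉ S := by
    have := Fintype.ofFinite V
    rw [Nat.card_eq_fintype_card] at hk
    exact Finset.exists_mem_notMem_of_card_lt_card (s := S) (t := Finset.univ)
      (by simpa using hS.trans hk) |>.imp fun _ => And.right
  refine connected_of_forall_eq_or_adj_or_exists ⟨v, by simpa using hv⟩ fun w => ?_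
  exact or_iff_not_imp_left.2 fun hw =>
    Or.inl (hG _ _ fun h => hw (Subtype.ext h.symm))

theorem IsKConnected.of_sup_edge [Fintype V] [DecidableRel G.Adj] {k : ℕ} {u v : V}
    (h : IsKConnected k (G ⊔ SimpleGraph.fromEdgeSet {s(u, v)}))
    (huv : k ≤ (Finset.univ.filter fun w => G.Adj u w ∧ G.Adj w v).card) : IsKConnected k G := by
  refine ⟨h.1, fun S hS => ?_⟩
  obtain ⟨w, hw, hwS⟩ := Finset.exists_mem_notMem_of_card_lt_card (hS.trans_le huv)
  obtain ⟨huw, hwv⟩ := (Finset.mem_filter.1 hw).2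
  have hreach (hu : u ∈ (S : Set V)ᶜ) (hv : v ∈ (S : Set V)ᶜ) :
      (G.induce (S : Set V)ᶜ).Reachable ⟨u, hu⟩ ⟨v, hv⟩ :=
    have huw' : (G.induce (S : Set V)ᶜ).Adj ⟨u, hu⟩ ⟨w, hwS⟩ := huw
    have hwv' : (G.induce (S : Set V)ᶜ).Adj ⟨w, hwS⟩ ⟨v, hv⟩ := hwv
    huw'.reachable.trans hwv'.reachable
  have hadj : ∀ a b, ((G ⊔ SimpleGraph.fromEdgeSet {s(u, v)}).induce (S : Set V)ᶜ).Adj a b →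
      (G.induce (S : Set V)ᶜ).Reachable a b := by
    rintro ⟨a, ha⟩ ⟨b, hb⟩ (hab | hab)
    · exact SimpleGraph.Adj.reachable (G := G.induce (S : Set V)ᶜ) hab
    · obtain ⟨rfl, rfl⟩ | ⟨rfl, rfl⟩ := Sym2.eq_iff.1 hab.1
      exacts [hreach ha hb, (hreach hb ha).symm]
  have hconn := h.2 S hS
  exact { preconnected := fun a b => reachable_of_forall_adj (f := id) hadj (hconn.preconnected a b)
          nonempty := hconn.nonempty }

/-- Adding the listed pairs to `G` one by one as edges, where each of them has at least `k` common
neighbours when it is added, leads to a complete graph. -/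
def IsCompletion [Fintype V] [DecidableEq V] (k : ℕ) :
    ∀ (G : SimpleGraph V) [DecidableRel G.Adj], List (V × V) → Prop
  | G, _, [] => ∀ u v, u ≠ v → G.Adj u v
  | G, _, (u, v) :: L => k ≤ (Finset.univ.filter fun w => G.Adj u w ∧ G.Adj w v).card ∧
      IsCompletion k (G ⊔ SimpleGraph.fromEdgeSet {s(u, v)}) L

instance IsCompletion.decidable [Fintype V] [DecidableEq V] (k : ℕ) :
    ∀ (G : SimpleGraph V) [DecidableRel G.Adj] (L : List (V × V)), Decidable (IsCompletion k G L)
  | G, _, [] => inferInstanceAs (Decidable (∀ u v, u ≠ v → G.Adj u v))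
  | G, _, (u, v) :: L =>
    have := IsCompletion.decidable k (G ⊔ SimpleGraph.fromEdgeSet {s(u, v)}) L
    inferInstanceAs (Decidable (k ≤ (Finset.univ.filter fun w => G.Adj u w ∧ G.Adj w v).card ∧ _))

theorem IsCompletion.isKConnected [Fintype V] [DecidableEq V] [DecidableRel G.Adj] {k : ℕ}
    {L : List (V × V)} (h : IsCompletion k G L) (hk : k < Nat.card V) : IsKConnected k G := by
  induction L generalizing G with
  | nil => exact isKConnected_of_forall_ne_adj hk h
  | cons e L ih => exact (ih h.2).of_sup_edge h.1

end Connectedness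

section Example

/-- The side of a face in the list `Q` of faces which leads in opposite direction along the same
edge as the side `c`. The default value `c` is irrelevant for a surface without boundary. -/
def oppositeSide {n m : ℕ} (Q : Fin n → Fin 4 → Fin m) (c : Fin n × Fin 4) : Fin n × Fin 4 :=
  ((List.finRange n ×ˢ List.finRange 4).find? fun d =>
    Q d.1 d.2 = Q c.1 (c.2 + 1) ∧ Q d.1 (d.2 + 1) = Q c.1 c.2).getD c

/-- The faces of the quadrangulation which underlies the 5-connected example. -/
def fiveConnectedFaces : Fin 11 → Fin 4 → Fin 13 :=
  ![![6, 2, 3, 4], ![7, 5, 4, 3], ![6, 4, 5, 0], ![7, 1, 0, 5], ![8, 9, 10, 11], ![6, 0, 9, 8],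
    ![0, 1, 10, 9], ![2, 6, 8, 11], ![12, 1, 7, 3], ![12, 3, 2, 11], ![12, 11, 10, 1]]

/-- The faces after the vertex `12` has been merged with the vertex `2`. -/
def reducedFaces : Fin 10 → Fin 4 → Fin 12 :=
  ![![6, 2, 3, 4], ![7, 5, 4, 3], ![6, 4, 5, 0], ![7, 1, 0, 5], ![8, 9, 10, 11], ![6, 0, 9, 8],
    ![0, 1, 10, 9], ![2, 6, 8, 11], ![1, 7, 3, 2], ![1, 2, 11, 10]]

/-- The quadrangulation with the faces `fiveConnectedFaces`. -/
def fiveConnectedMap : KiteMap (Fin 13) (Fin 11) where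
  vertex c := fiveConnectedFaces c.1 c.2
  mate := oppositeSide fiveConnectedFaces
  mate_mate := by decide +kernel
  vertex_mate := by decide +kernel
  vertex_injective := by decide +kernel
  vertex_surjective := by decide +kernel
  side_injective := by decide +kernel
  diagonal_injective := by decide +kernel
  side_ne_diagonal := by decide +kernel
  exists_iterate := by
    have h : ∀ c d : Fin 11 × Fin 4, fiveConnectedFaces c.1 c.2 = fiveConnectedFaces d.1 d.2 →
        ∃ n < 6, (fun c => ((oppositeSide fiveConnectedFaces c).1,
          (oppositeSide fiveConnectedFaces c).2 + 1))^[n] c = d := by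
      decide +kernel
    exact fun c d hcd => (h c d hcd).imp fun _ => And.right

/-- The quadrangulation with the faces `reducedFaces`. -/
def reducedMap : KiteMap (Fin 12) (Fin 10) where
  vertex c := reducedFaces c.1 c.2
  mate := oppositeSide reducedFaces
  mate_mate := by decide +kernel
  vertex_mate := by decide +kernel
  vertex_injective := by decide +kernel
  vertex_surjective := by decide +kernel
  side_injective := by decide +kernel
  diagonal_injective := by decide +kernel
  side_ne_diagonal := by decide +kernel
  exists_iterate := by
    have h : ∀ c d : Fin 10 × Fin 4, reducedFaces c.1 c.2 = reducedFaces d.1 d.2 →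
        ∃ n < 6, (fun c => ((oppositeSide reducedFaces c).1,
          (oppositeSide reducedFaces c).2 + 1))^[n] c = d := by
      decide +kernel
    exact fun c d hcd => (h c d hcd).imp fun _ => And.right

theorem isOptimalOnePlanar_fiveConnectedMap : IsOptimalOnePlanar fiveConnectedMap.graph :=
  fiveConnectedMap.isOptimalOnePlanar
    (connected_of_forall_eq_or_adj_or_exists 0 (by decide +kernel)) (by simp) (by simp)

theorem isOptimalOnePlanar_reducedMap : IsOptimalOnePlanar reducedMap.graph :=
  reducedMap.isOptimalOnePlanar
    (connected_of_forall_eq_or_adj_or_exists 0 (by decide +kernel)) (by simp) (by simp)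

theorem isKConnected_fiveConnectedMap : IsKConnected 5 fiveConnectedMap.graph := by
  have h : IsCompletion 5 fiveConnectedMap.graph
      [(0, 3), (0, 11), (0, 12), (1, 6), (1, 8), (3, 8), (3, 9), (3, 10), (6, 7), (6, 10), (6, 12),
        (7, 10), (7, 11), (8, 12), (9, 12), (0, 2), (1, 2), (1, 4), (2, 5), (2, 7), (2, 9),
        (2, 10), (4, 8), (4, 9), (4, 10), (4, 11), (4, 12), (5, 8), (5, 9), (5, 10), (5, 11),
        (5, 12), (7, 8), (7, 9)] := by
    decide +kernel
  exact h.isKConnected (by simp)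

theorem hasSeparation_reducedMap : HasSeparation 4 reducedMap.graph := by
  refine ⟨({3, 4, 5, 7} : Finset (Fin 12)), ({8, 9, 10, 11} : Finset (Fin 12)), {0, 1, 2, 6},
    { left_nonempty := ⟨3, by simp⟩
      right_nonempty := ⟨8, by simp⟩
      disjoint := Finset.disjoint_coe.2 (by decide)
      union_eq := by
        rw [← Finset.coe_union, ← Finset.coe_compl, Finset.coe_inj]
        decide
      not_adj := ?_ }, by decide⟩
  simp only [Finset.mem_coe]
  decide +kernel

/-- The neighbourhood of the vertex `12` in the 5-connected example. -/
def crossedStar : CrossedStar fiveConnectedMap.graph where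
  x := 12
  x₁ := 1
  x₂ := 7
  x₃ := 3
  x₄ := 2
  x₅ := 11
  x₆ := 10
  distinct := by decide
  neighbors := by
    have h : ∀ v : Fin 13, fiveConnectedMap.graph.Adj 12 v ↔
        v = 1 ∨ v = 7 ∨ v = 3 ∨ v = 2 ∨ v = 11 ∨ v = 10 := by decide +kernel
    exact Set.ext h
  adj₁₂ := by decide +kernel
  adj₂₃ := by decide +kernel
  adj₃₄ := by decide +kernel
  adj₄₅ := by decide +kernel
  adj₅₆ := by decide +kernel
  adj₆₁ := by decide +kernel
  adj₁₃ := by decide +kernel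
  adj₃₅ := by decide +kernel
  adj₅₁ := by decide +kernel

theorem feasible_crossedStar : crossedStar.Feasible :=
  ⟨by decide +kernel, by decide +kernel, by decide +kernel⟩

theorem srStep_fiveConnectedMap_reducedMap : SRStep fiveConnectedMap.graph reducedMap.graph := by
  have hadj : ∀ a b : Fin 12, reducedMap.graph.Adj a b ↔
      fiveConnectedMap.graph.Adj ((Fin.last 12).succAbove a) ((Fin.last 12).succAbove b) ∧
        s((Fin.last 12).succAbove a, (Fin.last 12).succAbove b) ≠ s(3, 11) ∨
      (∃ v ∈ ({1, 7, 10} : Finset (Fin 13)),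
        s(2, v) = s((Fin.last 12).succAbove a, (Fin.last 12).succAbove b)) ∧
        (Fin.last 12).succAbove a ≠ (Fin.last 12).succAbove b := by
    decide +kernel
  refine ⟨crossedStar, feasible_crossedStar,
    ⟨RelIso.symm ⟨finSuccAboveEquiv (Fin.last 12), fun {a b} => ?_⟩⟩⟩
  rw [hadj]
  refine crossedStar.reduct_adj_iff.trans ?_
  simp only [Finset.mem_insert, Finset.mem_singleton]
  rfl

end Example

end OptimalOnePlanar

theorem mainTheorem9 :
    (∃ (n m : ℕ) (G : SimpleGraph (Fin n)) (G' : SimpleGraph (Fin m)),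
      OptimalOnePlanar.IsOptimalOnePlanar G ∧ OptimalOnePlanar.IsKConnected 5 G ∧
        OptimalOnePlanar.SRStep G G' ∧
        OptimalOnePlanar.IsOptimalOnePlanar G' ∧ ¬ OptimalOnePlanar.IsKConnected 5 G') ∧
    (∀ (V W : Type u) [Finite V] (G : SimpleGraph V) (H : SimpleGraph W),
      OptimalOnePlanar.IsOptimalOnePlanar G → OptimalOnePlanar.HasSeparatingFourCycle G →
        OptimalOnePlanar.SRReducesTo G H → ¬ OptimalOnePlanar.IsExtendedWheel H) := by
  open OptimalOnePlanar in
  constructor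
  · exact ⟨13, 12, fiveConnectedMap.graph, reducedMap.graph, isOptimalOnePlanar_fiveConnectedMap,
      isKConnected_fiveConnectedMap, srStep_fiveConnectedMap_reducedMap,
      isOptimalOnePlanar_reducedMap, hasSeparation_reducedMap.not_isKConnected (by norm_num)⟩
  · rintro V W _ G H hG hsep hred ⟨k, hk, ⟨e⟩⟩
    have hH := (hred.hasSeparation (by norm_num) hG.hasKiteCover hsep.hasSeparation).2
    exact not_hasSeparation_extendedWheel hk (hH.of_iso e)
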